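/- A \emph{nonassociative relation algebra} is an algebra $\langle A;\vee,\wedge,\cdot,{}',{}^{\smile},0,1,e\rangle$ such that $\langle A;\vee,\wedge,{}',0,1\rangle$ is a Boolean algebra, $e$ is a two-sided identity element for $\cdot$, and for all $x,y,z\in A$ the triangle laws hold: \[ (x\cdot y)\wedge z=0 \iff (x^{\smile}\cdot z)\wedge y=0 \iff (z\cdot y^{\smile})\wedge x=0 . \] It is a \emph{relation algebra} if $\cdot$ is associative, and it is \emph{symmetric} if $x^{\smile}=x$ for all $x\in A$. Its atoms are the atoms of its Boolean algebra reduct. For $n\ge 1$ put $Q(n,n)=(n^3-n)/6$; this is the value at $s=n$ of $Q(n,s)=(n-1)\bigl((n-1)^2+3s-1\bigr)/6$. \textbf{Corollary.} Let $F(n)$ be the number of isomorphism classes of finite nonassociative relation algebras with exactly $n$ atoms. Then $2^{Q(n,n)}/(n-1)!$ is an asymptotic formula for $F(n)$, that is, \[ \lim_{n\to\infty}\frac{F(n)\,(n-1)!}{2^{Q(n,n)}}=1 . \] The same holds if $F(n)$ counts only those algebras that satisfy any given selection of the following three additional assumptions (one of them, or several together): the algebra is associative (i.e. a relation algebra); it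 is symmetric; $e$ is an atom. -/

import Mathlib

open Filter Asymptotics
open scoped Nat

/-- A nonassociative relation algebra: a Boolean algebra `A` with a binary operation `x * y`
(composition), a constant `1` that is a two-sided identity element for it, and a unary operation
`conv` (converse) satisfying the triangle laws.

In this notation `1` is the identity element `e` of the composition; the least and the greatest
element of the Boolean algebra are written `⊥` and `⊤`. -/
class NonassocRelAlgebra (A : Type*) extends BooleanAlgebra A, MulOneClass A where
  conv : A → A
  triangle_left : ∀ x y z : A, (x * y) ⊓ z = ⊥ ↔ (conv x * z) ⊓ y = ⊥
  triangle_right : ∀ x y z : A, (conv x * z) ⊓ y = ⊥ ↔ (z * conv y) ⊓ x = ⊥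

/-- An isomorphism of nonassociative relation algebras: a bijection that preserves
all the operations. -/
structure NonassocRelAlgebra.Iso (A B : Type*) [NonassocRelAlgebra A] [NonassocRelAlgebra B]
    extends A ≃ B where
  map_sup : ∀ x y, toFun (x ⊔ y) = toFun x ⊔ toFun y
  map_inf : ∀ x y, toFun (x ⊓ y) = toFun x ⊓ toFun y
  map_mul : ∀ x y, toFun (x * y) = toFun x * toFun y
  map_compl : ∀ x, toFun xᶜ = (toFun x)ᶜ
  map_conv : ∀ x, toFun (NonassocRelAlgebra.conv x) = NonassocRelAlgebra.conv (toFun x)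
  map_bot : toFun ⊥ = ⊥
  map_top : toFun ⊤ = ⊤
  map_one : toFun 1 = 1

/-- A finite nonassociative relation algebra, bundled with its universe. -/
structure FinNA : Type 1 where
  carrier : Type
  [str : NonassocRelAlgebra carrier]
  [finite : Finite carrier]

namespace FinNA

instance : CoeSort FinNA Type := ⟨FinNA.carrier⟩

instance (A : FinNA) : NonassocRelAlgebra A := A.str

instance (A : FinNA) : Finite A := A.finite

/-- The relation of being isomorphic. -/
instance isoSetoid : Setoid FinNA where
  r A B := Nonempty (NonassocRelAlgebra.Iso A B)
  iseqv :=
    { refl := fun A => ⟨⟨Equiv.refl A, fun _ _ => rfl, fun _ _ => rfl, fun _ _ => rfl,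
        fun _ => rfl, fun _ => rfl, rfl, rfl, rfl⟩⟩
      symm := by
        rintro A B ⟨f, h1, h2, h3, h4, h5, h6, h7, h8⟩
        refine ⟨⟨f.symm, fun x y => ?_, fun x y => ?_, fun x y => ?_, fun x => ?_, fun x => ?_,
          ?_, ?_, ?_⟩⟩ <;>
        simp only [Equiv.toFun_as_coe] at * <;>
        rw [Equiv.symm_apply_eq] <;>
        simp [*]
      trans := by
        rintro A B C ⟨f, h1, h2, h3, h4, h5, h6, h7, h8⟩ ⟨g, k1, k2, k3, k4, k5, k6, k7, k8⟩
        exact ⟨⟨f.trans g,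
          fun x y => (congrArg g (h1 x y)).trans (k1 _ _),
          fun x y => (congrArg g (h2 x y)).trans (k2 _ _),
          fun x y => (congrArg g (h3 x y)).trans (k3 _ _),
          fun x => (congrArg g (h4 x)).trans (k4 _),
          fun x => (congrArg g (h5 x)).trans (k5 _),
          (congrArg g h6).trans k6, (congrArg g h7).trans k7, (congrArg g h8).trans k8⟩⟩ }

/-- The number of atoms (of the Boolean algebra reduct). -/
noncomputable def atomCount (A : FinNA) : ℕ := {a : A | IsAtom a}.ncard

/-- `A` is associative, that is, `A` is a relation algebra. -/
def IsAssociative (A : FinNA) : Prop := ∀ x y z : A, (x * y) * z = x * (y * z)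

/-- `A` is symmetric: every element is its own converse. -/
def IsSymmetric (A : FinNA) : Prop := ∀ x : A, NonassocRelAlgebra.conv x = x

/-- The identity element `e` of `A` is an atom. -/
def IdentityIsAtom (A : FinNA) : Prop := IsAtom (1 : A)

/-- The number of isomorphism classes of `n`-atom finite nonassociative relation algebras
that have the property `P`. -/
noncomputable def numIsoClasses (n : ℕ) (P : FinNA → Prop) : ℕ :=
  {c : Quotient isoSetoid | ∃ A : FinNA, A.atomCount = n ∧ P A ∧ ⟦A⟧ = c}.ncard

end FinNA

/-- `Q(n, s) = (n - 1)((n - 1)² + 3s - 1) / 6`. -/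
def cycleCountQ (n s : ℕ) : ℕ := (n - 1) * ((n - 1) ^ 2 + 3 * s - 1) / 6

/-- On the diagonal, `Q(n, n) = (n³ - n) / 6`, and this division is exact. -/
theorem six_mul_cycleCountQ_self (n : ℕ) : 6 * cycleCountQ n n + n = n ^ 3 := by
  rcases n with _ | m
  · rfl
  · have h : m * (m ^ 2 + 3 * (m + 1) - 1) = m * (m + 1) * (m + 2) := by
      have : m ^ 2 + 3 * (m + 1) - 1 = (m + 1) * (m + 2) := by
        rw [Nat.sub_eq_iff_eq_add (by omega)]; ring
      rw [this]; ring
    have hd : 6 ∣ m * (m + 1) * (m + 2) := by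
      have := Nat.factorial_dvd_ascFactorial m 3
      simp only [Nat.ascFactorial, Nat.factorial] at this
      convert this using 1
      ring
    simp only [cycleCountQ, Nat.add_sub_cancel, h]
    rw [Nat.mul_div_cancel' hd]
    ring

/-! A finite algebra is determined by its atom structure: the set of atoms below the identity, the
converse on atoms, and the set of cycles, which is closed under rotation and reversal. Hence the
isomorphism classes with n atoms are at most as many as the orbits of the symmetric group on
labelled atom structures over `Fin n`.

Upper bound. By Burnside's lemma, n! times the number of orbits is the sum over σ of the number of
structures fixed by σ. Fix also the unit set I and the converse v. Cycles through a unit are almost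
forced, and the cycles on the complement D form a predicate that is constant on orbits of triples
under a twisted action of S₃, and constant along the cycles of the permutation that σ induces on
these orbits. With one unit, v = id and σ = id there are at most 2^Q choices. Every further unit,
every atom moved by v and every atom moved by σ costs at least n/24 in the exponent
(`card_inFiber_le`). With x = 2^(-n/24), the sum over I, v and σ factors and is at most 2^Q · n · (1
+ x)^n · (1 + (n - 1)x)^(2n). The powers tend to 1, and the factor n, the choice of a single
identity atom, turns n! into (n - 1)!.

Lower bound. Let the identity be an atom, the converse trivial, and choose any set T of 3-element
multisets of the m = n - 1 diversity atoms as cycles; there are 2^Q choices. Associativity follows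
if any a, b and c, d are linked through some x. For given a, b, c, d at least m - 4 elements x offer
separate chances, so all but a fraction m⁴(3/4)^(m-4) of the sets T are linked. An isomorphism
permutes the diversity atoms, so each class arises from at most (n - 1)! sets T.

The algebras of the lower bound have all three optional properties and the upper bound uses none, so
the same two bounds serve every selection. -/

namespace NonassocRelAlgebra

/-! ### Converse and cycles in a nonassociative relation algebra -/

section Basic

variable {A : Type*} [NonassocRelAlgebra A]

theorem eq_of_forall_inf_eq_bot_iff {B : Type*} [BooleanAlgebra B] {x y : B}
    (h : ∀ z, x ⊓ z = ⊥ ↔ y ⊓ z = ⊥) : x = y := by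
  have key : ∀ {x y : B}, (∀ z, x ⊓ z = ⊥ ↔ y ⊓ z = ⊥) → x ≤ y := by
    intro x y h
    have := (h yᶜ).2 inf_compl_eq_bot
    rwa [← disjoint_iff, disjoint_compl_right_iff] at this
  exact le_antisymm (key h) (key fun z => (h z).symm)

/-- Two uses of the triangle law show that both elements are disjoint from the same z: each
condition says that `conv x * z` is disjoint from the identity. -/
theorem conv_conv (x : A) : conv (conv x) = x := by
  have h : conv (conv x) * 1 = x * 1 := eq_of_forall_inf_eq_bot_iff fun z => by
    rw [triangle_left x 1 z, triangle_left (conv x) z 1]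
  simpa using h

theorem conv_inf_eq_bot_iff (x y : A) : conv x ⊓ y = ⊥ ↔ x ⊓ conv y = ⊥ := by
  have := triangle_right x y 1
  rwa [mul_one, one_mul, inf_comm (conv y)] at this

theorem conv_mono {x y : A} (h : x ≤ y) : conv x ≤ conv y := by
  have h1 : y ⊓ conv (conv y)ᶜ = ⊥ := by
    rw [← conv_inf_eq_bot_iff]; exact inf_compl_eq_bot
  have h2 : x ⊓ conv (conv y)ᶜ = ⊥ := le_bot_iff.1 ((inf_le_inf_right _ h).trans h1.le)
  rwa [← conv_inf_eq_bot_iff, ← disjoint_iff, disjoint_compl_right_iff] at h2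

/-- Converse as an order isomorphism. -/
def convIso : A ≃o A where
  toFun := conv
  invFun := conv
  left_inv := conv_conv
  right_inv := conv_conv
  map_rel_iff' {x y} :=
    ⟨fun h => by simpa only [Equiv.coe_fn_mk, conv_conv] using conv_mono h, conv_mono⟩

theorem conv_le_iff {x y : A} : conv x ≤ y ↔ x ≤ conv y :=
  ⟨fun h => conv_conv x ▸ conv_mono h, fun h => conv_conv y ▸ conv_mono h⟩

theorem isAtom_conv {x : A} (h : IsAtom x) : IsAtom (conv x) :=
  (OrderIso.isAtom_iff (convIso (A := A)) x).2 h

theorem not_inf_eq_bot_iff_le {x c : A} (hc : IsAtom c) : ¬ (x ⊓ c = ⊥) ↔ c ≤ x := by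
  rw [inf_comm, ← disjoint_iff, hc.not_disjoint_iff_le]

/-- The cycle relation, in its cyclically symmetric form. -/
def Cycle (a b c : A) : Prop := ¬ ((a * b) ⊓ conv c = ⊥)

/-- Rotation and `cycle_reverse` together express the triangle laws as a symmetry under a group of
order six, which is what the orbit count for cycles relies on. -/
theorem cycle_rotate (a b c : A) : Cycle a b c ↔ Cycle b c a := by
  unfold Cycle
  rw [triangle_left b c, triangle_right, triangle_left a b]

theorem cycle_reverse (a b c : A) : Cycle a b c ↔ Cycle (conv c) (conv b) (conv a) := by
  unfold Cycle
  rw [triangle_left a b, triangle_right, conv_conv]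

theorem cycle_iff_le {a b c : A} (hc : IsAtom c) : Cycle a b c ↔ conv c ≤ a * b :=
  not_inf_eq_bot_iff_le (isAtom_conv hc)

theorem conv_one : conv (1 : A) = 1 := by
  have h : ∀ z : A, conv 1 ⊓ z = ⊥ ↔ 1 ⊓ z = ⊥ := fun z => by
    have h2 := triangle_left (1 : A) z 1
    rw [one_mul, mul_one] at h2
    rw [← h2, inf_comm]
  exact eq_of_forall_inf_eq_bot_iff h

/-- A cycle decomposes into cycles of atoms. -/
theorem cycle_iff_exists_atoms [IsAtomic A] (x y c : A) :
    Cycle x y c ↔ ∃ a b : A, IsAtom a ∧ IsAtom b ∧ a ≤ x ∧ b ≤ y ∧ Cycle a b c := by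
  have first : ∀ x y c : A, Cycle x y c ↔ ∃ a, IsAtom a ∧ a ≤ x ∧ Cycle a y c := by
    intro x y c
    have e : ∀ x, Cycle x y c ↔ ¬ ((y * c) ⊓ conv x = ⊥) := fun x => cycle_rotate x y c
    -- In this form the dependence on x is just that x meets a fixed element, which atomicity
    -- splits.
    have e' : ∀ x, Cycle x y c ↔ ¬ (conv (y * c) ⊓ x = ⊥) := fun x => by
      rw [e, conv_inf_eq_bot_iff]
    simp only [e']
    constructor
    · intro h
      obtain ⟨a, ha, hle⟩ := (eq_bot_or_exists_atom_le (conv (y * c) ⊓ x)).resolve_left h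
      refine ⟨a, ha, hle.trans inf_le_right, ?_⟩
      rw [not_inf_eq_bot_iff_le ha]
      exact hle.trans inf_le_left
    · rintro ⟨a, ha, hle, h⟩ h0
      exact h (le_bot_iff.1 ((inf_le_inf_left _ hle).trans h0.le))
  constructor
  · intro h
    obtain ⟨a, ha, hax, h1⟩ := (first _ _ _).1 h
    obtain ⟨b, hb, hby, h2⟩ := (first _ _ _).1 ((cycle_rotate _ _ _).1 h1)
    exact ⟨a, b, ha, hb, hax, hby, (cycle_rotate _ _ _).2 h2⟩
  · rintro ⟨a, b, ha, hb, hax, hby, h⟩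
    exact (first _ _ _).2 ⟨a, ha, hax, (cycle_rotate _ _ _).2
      ((first _ _ _).2 ⟨b, hb, hby, (cycle_rotate _ _ _).1 h⟩)⟩

end Basic

end NonassocRelAlgebra

/-! ### Atom structures determine finite algebras -/

/-- The relational data carried by the atoms of a nonassociative relation algebra. -/
@[ext] structure AtomStructure (ι : Type*) where
  unit : ι → Prop
  inv : ι → ι
  cyc : ι → ι → ι → Prop

namespace AtomStructure

open NonassocRelAlgebra

variable {ι : Type*}

/-- Relabelling of an atom structure. -/
instance : MulAction (Equiv.Perm ι) (AtomStructure ι) where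
  smul σ T :=
    { unit := fun i => T.unit (σ⁻¹ i)
      inv := fun i => σ (T.inv (σ⁻¹ i))
      cyc := fun i j k => T.cyc (σ⁻¹ i) (σ⁻¹ j) (σ⁻¹ k) }
  one_smul T := by
    ext <;> simp [HSMul.hSMul]
  mul_smul σ τ T := by
    ext <;> simp [HSMul.hSMul]

theorem smul_unit (σ : Equiv.Perm ι) (T : AtomStructure ι) (i : ι) :
    (σ • T).unit i ↔ T.unit (σ⁻¹ i) := Iff.rfl

theorem smul_inv (σ : Equiv.Perm ι) (T : AtomStructure ι) (i : ι) :
    (σ • T).inv i = σ (T.inv (σ⁻¹ i)) := rfl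

theorem smul_cyc (σ : Equiv.Perm ι) (T : AtomStructure ι) (i j k : ι) :
    (σ • T).cyc i j k ↔ T.cyc (σ⁻¹ i) (σ⁻¹ j) (σ⁻¹ k) := Iff.rfl

/-- An atom structure is determined by its three components. -/
def equivProd (ι : Type*) :
    AtomStructure ι ≃ (ι → Prop) × (ι → ι) × (ι → ι → ι → Prop) where
  toFun T := (T.unit, T.inv, T.cyc)
  invFun p := ⟨p.1, p.2.1, p.2.2⟩
  left_inv _ := rfl
  right_inv _ := rfl

instance [Finite ι] : Finite (AtomStructure ι) := Finite.of_equiv _ (equivProd ι).symm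

section OfLabel

variable {A : Type*} [NonassocRelAlgebra A]

/-- The atom structure of an algebra whose atoms are labelled by `ι`. -/
def ofLabel (e : ι ≃ {a : A // IsAtom a}) : AtomStructure ι where
  unit i := (e i : A) ≤ 1
  inv i := e.symm ⟨conv (e i : A), isAtom_conv (e i).2⟩
  cyc i j k := Cycle (e i : A) (e j) (e k)

theorem coe_inv_ofLabel (e : ι ≃ {a : A // IsAtom a}) (i : ι) :
    (e ((ofLabel e).inv i) : A) = conv (e i : A) := by
  simp [ofLabel]

theorem smul_ofLabel (e : ι ≃ {a : A // IsAtom a}) (σ : Equiv.Perm ι) :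
    σ • ofLabel e = ofLabel ((σ⁻¹ : Equiv.Perm ι).trans e) := rfl

/-- The atom labels below an element. -/
def below (e : ι ≃ {a : A // IsAtom a}) (x : A) : Set ι := {i | (e i : A) ≤ x}

theorem below_conv (e : ι ≃ {a : A // IsAtom a}) (x : A) (i : ι) :
    i ∈ below e (conv x) ↔ (ofLabel e).inv i ∈ below e x := by
  change (e i : A) ≤ conv x ↔ (e ((ofLabel e).inv i) : A) ≤ x
  rw [coe_inv_ofLabel, conv_le_iff]

variable [Finite A]

theorem below_mul (e : ι ≃ {a : A // IsAtom a}) (x y : A) (k : ι) :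
    k ∈ below e (x * y) ↔
      ∃ i j, i ∈ below e x ∧ j ∈ below e y ∧ (ofLabel e).cyc i j ((ofLabel e).inv k) := by
  have h1 : k ∈ below e (x * y) ↔ Cycle x y (conv (e k : A)) := by
    rw [cycle_iff_le (isAtom_conv (e k).2), conv_conv]; rfl
  rw [h1, cycle_iff_exists_atoms]
  constructor
  · rintro ⟨a, b, ha, hb, hax, hby, h⟩
    refine ⟨e.symm ⟨a, ha⟩, e.symm ⟨b, hb⟩, ?_, ?_, ?_⟩
    · simpa [below] using hax
    · simpa [below] using hby
    · change Cycle _ _ (e ((ofLabel e).inv k) : A)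
      rw [coe_inv_ofLabel]
      simpa using h
  · rintro ⟨i, j, hi, hj, h⟩
    refine ⟨e i, e j, (e i).2, (e j).2, hi, hj, ?_⟩
    rw [← coe_inv_ofLabel]
    exact h

/-- A finite algebra is order isomorphic to the power set of its atoms. -/
noncomputable def belowIso (e : ι ≃ {a : A // IsAtom a}) : A ≃o Set ι := by
  have hle : ∀ x y : A, below e x ⊆ below e y ↔ x ≤ y := by
    intro x y
    refine ⟨fun h => ?_, fun h i hi => le_trans (α := A) hi h⟩
    by_contra hxy
    have : x ⊓ yᶜ ≠ ⊥ := fun h0 => hxy (by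
      rwa [← disjoint_iff, disjoint_compl_right_iff] at h0)
    obtain ⟨a, ha, hle⟩ := (eq_bot_or_exists_atom_le (x ⊓ yᶜ)).resolve_left this
    have h1 : e.symm ⟨a, ha⟩ ∈ below e x := by
      simpa [below] using hle.trans inf_le_left
    have h2 : a ≤ y := by simpa [below] using h h1
    exact ha.1 (le_bot_iff.1 ((le_inf h2 (hle.trans inf_le_right)).trans inf_compl_eq_bot.le))
  refine
    { toEquiv := Equiv.ofBijective (below e) ⟨fun x y h => ?_, fun s => ?_⟩
      map_rel_iff' := hle _ _ }
  · exact le_antisymm ((hle _ _).1 h.le) ((hle _ _).1 h.ge)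
  · have : Finite ι := Finite.of_equiv _ e.symm
    classical
    cases nonempty_fintype ι
    refine ⟨(Finset.univ.filter (· ∈ s)).sup fun i => (e i : A), ?_⟩
    ext i
    constructor
    · intro h
      by_contra hi
      have h0 : Disjoint (e i : A) ((Finset.univ.filter (· ∈ s)).sup fun i => (e i : A)) := by
        rw [Finset.disjoint_sup_right]
        intro j hj
        refine (e i).2.disjoint_of_ne (e j).2 fun hij => hi ?_
        rw [e.injective (Subtype.ext hij)]
        simpa using hj
      exact (e i).2.1 (h0.eq_bot_of_le h)
    · intro h
      exact Finset.le_sup (f := fun i => (e i : A)) (by simpa using h)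

/-- Algebras with equal atom structures are isomorphic. -/
theorem nonempty_iso_of_ofLabel_eq {B : Type*} [NonassocRelAlgebra B] [Finite B]
    (e : ι ≃ {a : A // IsAtom a}) (f : ι ≃ {a : B // IsAtom a}) (h : ofLabel e = ofLabel f) :
    Nonempty (NonassocRelAlgebra.Iso A B) := by
  -- `u` matches elements with the same atom labels below them; composition, converse and identity
  -- depend only on these labels and the common atom structure.
  let u : A ≃o B := (belowIso e).trans (belowIso f).symm
  have hu : ∀ x, below f (u x) = below e x := fun x => (belowIso f).apply_symm_apply _
  have inj : ∀ {x y : B}, below f x = below f y → x = y := fun h => (belowIso f).injective h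
  refine ⟨⟨u.toEquiv, fun x y => map_sup u x y, fun x y => map_inf u x y, fun x y => ?_,
    fun x => map_compl' u x, fun x => ?_, map_bot u, map_top u, ?_⟩⟩
  · apply inj
    change below f (u (x * y)) = below f (u x * u y)
    ext k
    rw [hu, below_mul, below_mul, hu, hu, h]
  · apply inj
    change below f (u (conv x)) = below f (conv (u x))
    ext k
    rw [hu, below_conv, below_conv, hu, h]
  · apply inj
    change below f (u 1) = below f 1
    rw [hu]
    exact congrArg (fun T => {i | AtomStructure.unit T i}) h

end OfLabel

/-- Transport of a labelling along an isomorphism. -/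
theorem exists_ofLabel_eq_of_iso {A B : Type*} [NonassocRelAlgebra A] [NonassocRelAlgebra B]
    (u : NonassocRelAlgebra.Iso A B) (e : ι ≃ {a : A // IsAtom a}) :
    ∃ f : ι ≃ {b : B // IsAtom b}, ofLabel f = ofLabel e := by
  have hle : ∀ x y, u.toFun x ≤ u.toFun y ↔ x ≤ y := fun x y => by
    rw [← sup_eq_right, ← u.map_sup, ← sup_eq_right]
    exact u.toEquiv.injective.eq_iff
  let w : A ≃o B := { toEquiv := u.toEquiv, map_rel_iff' := hle _ _ }
  let f : ι ≃ {b : B // IsAtom b} :=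
    e.trans (w.toEquiv.subtypeEquiv fun a => (w.isAtom_iff a).symm)
  have hf : ∀ i, (f i : B) = u.toFun (e i) := fun i => rfl
  refine ⟨f, AtomStructure.ext ?_ ?_ ?_⟩
  · funext i
    change ((f i : B) ≤ 1) = ((e i : A) ≤ 1)
    rw [hf, ← u.map_one, hle]
  · funext i
    apply f.injective
    apply Subtype.ext
    rw [coe_inv_ofLabel, hf, hf, coe_inv_ofLabel, u.map_conv]
  · funext i j k
    change (¬ _) = (¬ _)
    rw [hf, hf, hf, ← u.map_mul, ← u.map_conv, ← u.map_inf, ← u.map_bot]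
    rw [show (u.toFun _ = u.toFun _) = _ from propext u.toEquiv.injective.eq_iff]

/-- The properties of the atom structure of a finite algebra. -/
structure Regular (T : AtomStructure ι) : Prop where
  inv_inv : ∀ i, T.inv (T.inv i) = i
  inv_unit : ∀ i, T.unit i → T.inv i = i
  rotate : ∀ i j k, T.cyc i j k ↔ T.cyc j k i
  reverse : ∀ i j k, T.cyc i j k ↔ T.cyc (T.inv k) (T.inv j) (T.inv i)
  unit_cyc : ∀ i j k, T.unit i → T.cyc i j k → k = T.inv j
  unit_unit : ∀ i j, T.unit i → T.unit j → (T.cyc i j j ↔ i = j)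
  exists_unit : ∀ j, ∃ i, T.unit i ∧ T.cyc i j (T.inv j)

theorem regular_ofLabel {A : Type*} [NonassocRelAlgebra A] [Finite A]
    (e : ι ≃ {a : A // IsAtom a}) : (ofLabel e).Regular := by
  have ext' : ∀ {i j}, (e i : A) = e j → i = j := fun h => e.injective (Subtype.ext h)
  have inv_inv : ∀ i, (ofLabel e).inv ((ofLabel e).inv i) = i := fun i => ext' (by
    rw [coe_inv_ofLabel, coe_inv_ofLabel, conv_conv])
  have rotate : ∀ i j k, (ofLabel e).cyc i j k ↔ (ofLabel e).cyc j k i :=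
    fun i j k => cycle_rotate _ _ _
  have unit_cyc : ∀ i j k, (ofLabel e).unit i → (ofLabel e).cyc i j k →
      k = (ofLabel e).inv j := by
    intro i j k hi h
    have h1 : Cycle (1 : A) (e j) (e k) := (cycle_iff_exists_atoms _ _ _).2
      ⟨e i, e j, (e i).2, (e j).2, hi, le_rfl, h⟩
    rw [cycle_iff_le (e k).2, one_mul] at h1
    have h2 := ((e j).2.le_iff_eq (isAtom_conv (e k).2).1).1 h1
    apply ext'
    rw [coe_inv_ofLabel, ← h2, conv_conv]
  have exists_unit : ∀ j, ∃ i, (ofLabel e).unit i ∧ (ofLabel e).cyc i j ((ofLabel e).inv j) := by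
    intro j
    have h1 : j ∈ below e (1 * (e j : A)) := by rw [one_mul]; exact le_refl (e j : A)
    obtain ⟨i, j', hi, hj', h⟩ := (below_mul _ _ _ _).1 h1
    have : j' = j := ext' (((e j).2.le_iff_eq (e j').2.1).1 hj')
    exact ⟨i, hi, this ▸ h⟩
  have inv_unit : ∀ i, (ofLabel e).unit i → (ofLabel e).inv i = i := by
    intro i hi
    -- The cycle consists of k, the converse of i, and i. Rotating it so that each of the units i
    -- and `inv i` comes first forces k to equal both.
    obtain ⟨k, hk, h⟩ := exists_unit ((ofLabel e).inv i)
    rw [inv_inv] at h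
    have h1 := unit_cyc _ _ _ hi ((rotate _ _ _).1 ((rotate _ _ _).1 h))
    have h2 : (ofLabel e).unit ((ofLabel e).inv i) := by
      change (e ((ofLabel e).inv i) : A) ≤ 1
      rw [coe_inv_ofLabel, conv_le_iff, conv_one]
      exact hi
    have h3 := unit_cyc _ _ _ h2 ((rotate _ _ _).1 h)
    rw [← inv_inv k, ← h1, inv_inv] at h3
    exact h3.symm
  refine ⟨inv_inv, inv_unit, rotate, fun i j k => ?_, unit_cyc, fun i j hi hj => ?_, exists_unit⟩
  · change Cycle _ _ _ ↔ Cycle _ _ _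
    rw [coe_inv_ofLabel, coe_inv_ofLabel, coe_inv_ofLabel]
    exact cycle_reverse _ _ _
  · constructor
    · intro h
      have := unit_cyc _ _ _ hj ((rotate _ _ _).1 h)
      rw [this, inv_unit j hj]
    · rintro rfl
      obtain ⟨k, hk, h⟩ := exists_unit i
      rw [inv_unit i hi] at h
      have := unit_cyc _ _ _ hi ((rotate _ _ _).1 h)
      rw [inv_unit i hi] at this
      exact this ▸ h

end AtomStructure

/-! ### Counting invariant ternary predicates through orbits of triples -/

section InvariantPredicates

open Finset

/-- The number of cycles of a permutation is at most the mean of the number of points and the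
number of fixed points. -/
theorem Equiv.Perm.two_mul_card_quotient_sameCycle_le {Y : Type*} [Finite Y]
    (τ : Equiv.Perm Y) :
    2 * Nat.card (Quotient (Equiv.Perm.SameCycle.setoid τ)) ≤
      Nat.card Y + Nat.card {y // τ y = y} := by
  classical
  cases nonempty_fintype Y
  let := Fintype.ofFinite (Quotient (Equiv.Perm.SameCycle.setoid τ))
  let p : Y → Quotient (Equiv.Perm.SameCycle.setoid τ) := Quotient.mk _
  rw [Nat.card_eq_fintype_card, Nat.card_eq_fintype_card, Nat.card_eq_fintype_card,
    Fintype.card_subtype, ← card_univ, ← card_univ,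
    card_eq_sum_card_fiberwise (f := p) (t := univ) (by simp),
    card_eq_sum_card_fiberwise (s := univ.filter fun y => τ y = y) (f := p) (t := univ) (by simp),
    ← sum_add_distrib, mul_comm, ← smul_eq_mul, ← sum_const]
  refine sum_le_sum fun q _ => ?_
  obtain ⟨y, rfl⟩ := Quotient.exists_rep q
  by_cases hy : τ y = y
  · have h1 : 1 ≤ #{a | p a = p y} := card_pos.2 ⟨y, by simp⟩
    have h2 : 1 ≤ #{a ∈ univ.filter (fun y => τ y = y) | p a = p y} :=
      card_pos.2 ⟨y, by simp [hy]⟩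
    exact add_le_add h1 h2
  · refine le_add_right ?_
    have : ({y, τ y} : Finset Y) ⊆ ({a | p a = p y} : Finset Y) := by
      intro z hz
      rw [mem_insert, mem_singleton] at hz
      rw [mem_filter]
      refine ⟨mem_univ _, ?_⟩
      rcases hz with rfl | rfl
      · rfl
      · exact Quotient.sound (s := Equiv.Perm.SameCycle.setoid τ)
          (Equiv.Perm.sameCycle_apply_left.2 (Equiv.Perm.SameCycle.refl τ y))
    exact (card_pair (Ne.symm hy)).symm.le.trans (card_le_card this)

variable {D : Type*}

/-- Triples, on which the permutations of the three positions act so that odd permutations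
also apply the involution `v` to the entries. -/
def TwistedTriple (v : D → D) (_ : Function.Involutive v) : Type _ := Fin 3 → D

/-- The power of `v` given by a sign. -/
def signPow (v : D → D) (ε : ℤˣ) : D → D := if ε = 1 then id else v

theorem signPow_mul {v : D → D} (hv : Function.Involutive v) (ε δ : ℤˣ) (a : D) :
    signPow v (ε * δ) a = signPow v ε (signPow v δ a) := by
  rcases Int.units_eq_one_or ε with rfl | rfl <;> rcases Int.units_eq_one_or δ with rfl | rfl <;>
    simp [signPow, hv a, show (-1 : ℤˣ) ≠ 1 by decide]

instance (v : D → D) (hv : Function.Involutive v) :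
    MulAction (Equiv.Perm (Fin 3)) (TwistedTriple v hv) where
  smul g x := fun i => signPow v (Equiv.Perm.sign g) (x (g⁻¹ i))
  one_smul x := by
    funext i
    simp [HSMul.hSMul, signPow]
  mul_smul g h x := by
    funext i
    change signPow v (Equiv.Perm.sign (g * h)) (x ((g * h)⁻¹ i)) =
      signPow v (Equiv.Perm.sign g) (signPow v (Equiv.Perm.sign h) (x (h⁻¹ (g⁻¹ i))))
    rw [map_mul, signPow_mul hv, mul_inv_rev, Equiv.Perm.mul_apply]

variable {v : D → D} {hv : Function.Involutive v}

theorem TwistedTriple.smul_apply (g : Equiv.Perm (Fin 3)) (x : TwistedTriple v hv) (i : Fin 3) :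
    (g • x) i = signPow v (Equiv.Perm.sign g) (x (g⁻¹ i)) := rfl

instance [Finite D] : Finite (TwistedTriple v hv) := inferInstanceAs (Finite (Fin 3 → D))

theorem perm_fin_three_cases (g : Equiv.Perm (Fin 3)) :
    (Equiv.Perm.sign g = 1 ∧
      ((g⁻¹ 0 = 0 ∧ g⁻¹ 1 = 1 ∧ g⁻¹ 2 = 2) ∨ (g⁻¹ 0 = 1 ∧ g⁻¹ 1 = 2 ∧ g⁻¹ 2 = 0) ∨
        (g⁻¹ 0 = 2 ∧ g⁻¹ 1 = 0 ∧ g⁻¹ 2 = 1))) ∨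
    (Equiv.Perm.sign g = -1 ∧
      ((g⁻¹ 0 = 2 ∧ g⁻¹ 1 = 1 ∧ g⁻¹ 2 = 0) ∨ (g⁻¹ 0 = 1 ∧ g⁻¹ 1 = 0 ∧ g⁻¹ 2 = 2) ∨
        (g⁻¹ 0 = 0 ∧ g⁻¹ 1 = 2 ∧ g⁻¹ 2 = 1))) := by
  revert g; decide

/-- The entries of an image of a triple. -/
theorem TwistedTriple.smul_cases (g : Equiv.Perm (Fin 3)) (x : TwistedTriple v hv) :
    ((((g • x) 0 = x 0 ∧ (g • x) 1 = x 1 ∧ (g • x) 2 = x 2) ∨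
      ((g • x) 0 = x 1 ∧ (g • x) 1 = x 2 ∧ (g • x) 2 = x 0) ∨
      ((g • x) 0 = x 2 ∧ (g • x) 1 = x 0 ∧ (g • x) 2 = x 1))) ∨
    (((g • x) 0 = v (x 2) ∧ (g • x) 1 = v (x 1) ∧ (g • x) 2 = v (x 0)) ∨
      ((g • x) 0 = v (x 1) ∧ (g • x) 1 = v (x 0) ∧ (g • x) 2 = v (x 2)) ∨
      ((g • x) 0 = v (x 0) ∧ (g • x) 1 = v (x 2) ∧ (g • x) 2 = v (x 1))) := by
  simp only [TwistedTriple.smul_apply]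
  rcases perm_fin_three_cases g with ⟨hs, h⟩ | ⟨hs, h⟩
  · left
    rcases h with ⟨h0, h1, h2⟩ | ⟨h0, h1, h2⟩ | ⟨h0, h1, h2⟩ <;>
      simp [hs, h0, h1, h2, signPow]
  · right
    rcases h with ⟨h0, h1, h2⟩ | ⟨h0, h1, h2⟩ | ⟨h0, h1, h2⟩ <;>
      simp [hs, h0, h1, h2, signPow, show (-1 : ℤˣ) ≠ 1 by decide]

theorem TwistedTriple.pred_smul_iff {P : D → D → D → Prop}
    (rot : ∀ a b c, P a b c ↔ P b c a) (rev : ∀ a b c, P a b c ↔ P (v c) (v b) (v a))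
    (g : Equiv.Perm (Fin 3)) (x : TwistedTriple v hv) :
    P ((g • x) 0) ((g • x) 1) ((g • x) 2) ↔ P (x 0) (x 1) (x 2) := by
  rcases TwistedTriple.smul_cases g x with
    (⟨h0, h1, h2⟩ | ⟨h0, h1, h2⟩ | ⟨h0, h1, h2⟩) |
    (⟨h0, h1, h2⟩ | ⟨h0, h1, h2⟩ | ⟨h0, h1, h2⟩) <;> rw [h0, h1, h2]
  · exact (rot _ _ _).symm
  · exact rot _ _ _
  · exact (rev _ _ _).symm
  · rw [rev (x 0), rot, ← rot, ← rot]
  · rw [rev (x 0), rot]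

theorem TwistedTriple.ext' {x y : TwistedTriple v hv} (h0 : x 0 = y 0) (h1 : x 1 = y 1)
    (h2 : x 2 = y 2) : x = y := by
  funext i; fin_cases i <;> assumption

/-- Bounds on the number of triples fixed by a permutation of the positions. -/
theorem TwistedTriple.card_fixedBy_le [Finite D] (g : Equiv.Perm (Fin 3)) :
    Nat.card (MulAction.fixedBy (TwistedTriple v hv) g) ≤
      if g = 1 then Nat.card D ^ 3 else if Equiv.Perm.sign g = 1 then Nat.card D
        else Nat.card {a // v a = a} * Nat.card D := by
  split_ifs with h1 hs
  · calc _ ≤ Nat.card (Fin 3 → D) := Nat.card_le_card_of_injective _ Subtype.val_injective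
      _ = _ := by rw [Nat.card_fun]; simp
  · refine Nat.card_le_card_of_injective (fun x => x.1 0) fun x y hxy => ?_
    -- For a 3-cycle, a fixed triple is constant.
    have key : ∀ x : MulAction.fixedBy (TwistedTriple v hv) g, x.1 1 = x.1 0 ∧ x.1 2 = x.1 0 := by
      rintro ⟨x, hx⟩
      have hx : g • x = x := hx
      have hi : ∀ i, x (g⁻¹ i) = x i := fun i => by
        have := congrFun hx i
        rwa [TwistedTriple.smul_apply, hs, signPow, if_pos rfl] at this
      rcases perm_fin_three_cases g with ⟨_, h⟩ | ⟨hs', _⟩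
      · rcases h with h | h | h
        · exfalso; apply h1
          rw [← inv_eq_one]
          ext i; fin_cases i <;> simp [h.1, h.2.1, h.2.2]
        · have a := hi 0; have b := hi 1; have c := hi 2
          rw [h.1] at a; rw [h.2.1] at b
          exact ⟨a, b.trans a⟩
        · have a := hi 0; have b := hi 1; have c := hi 2
          rw [h.1] at a; rw [h.2.1] at b
          exact ⟨b.symm, a⟩
      · rw [hs] at hs'; exact absurd hs' (by decide)
    exact Subtype.ext (TwistedTriple.ext' hxy
      (((key x).1.trans hxy).trans (key y).1.symm) (((key x).2.trans hxy).trans (key y).2.symm))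
  · rw [← Nat.card_prod]
    have hs' : Equiv.Perm.sign g = -1 := (Int.units_eq_one_or _).resolve_left hs
    have hi : ∀ (x : MulAction.fixedBy (TwistedTriple v hv) g) i, v (x.1 (g⁻¹ i)) = x.1 i := by
      rintro ⟨x, hx⟩ i
      have hx : g • x = x := hx
      have := congrFun hx i
      rwa [TwistedTriple.smul_apply, hs', signPow, if_neg (by decide)] at this
    rcases perm_fin_three_cases g with ⟨hs', _⟩ | ⟨_, h⟩
    · exact absurd hs' hs
    -- For a transposition, the entry at its fixed position is fixed by `v`, and `v` exchanges the
    -- other two, so one of them determines the other.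
    · rcases h with ⟨h0, h1, h2⟩ | ⟨h0, h1, h2⟩ | ⟨h0, h1, h2⟩
      · refine Nat.card_le_card_of_injective
          (fun x => (⟨x.1 1, by have := hi x 1; rwa [h1] at this⟩, x.1 0)) fun x y hxy => ?_
        simp only [Prod.mk.injEq, Subtype.mk.injEq] at hxy
        refine Subtype.ext (TwistedTriple.ext' hxy.2 hxy.1 ?_)
        have a := hi x 2; have b := hi y 2
        rw [h2] at a b
        rw [← a, ← b, hxy.2]
      · refine Nat.card_le_card_of_injective
          (fun x => (⟨x.1 2, by have := hi x 2; rwa [h2] at this⟩, x.1 0)) fun x y hxy => ?_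
        simp only [Prod.mk.injEq, Subtype.mk.injEq] at hxy
        refine Subtype.ext (TwistedTriple.ext' hxy.2 ?_ hxy.1)
        have a := hi x 1; have b := hi y 1
        rw [h1] at a b
        rw [← a, ← b, hxy.2]
      · refine Nat.card_le_card_of_injective
          (fun x => (⟨x.1 0, by have := hi x 0; rwa [h0] at this⟩, x.1 1)) fun x y hxy => ?_
        simp only [Prod.mk.injEq, Subtype.mk.injEq] at hxy
        refine Subtype.ext (TwistedTriple.ext' hxy.1 hxy.2 ?_)
        have a := hi x 2; have b := hi y 2
        rw [h2] at a b
        rw [← a, ← b, hxy.2]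

/-- The orbits of twisted triples. -/
abbrev TripleOrbit (v : D → D) (hv : Function.Involutive v) :=
  MulAction.orbitRel.Quotient (Equiv.Perm (Fin 3)) (TwistedTriple v hv)

/-- Burnside's lemma for S₃: the three terms come from the identity, the two 3-cycles and the three
transpositions. -/
theorem six_mul_card_tripleOrbit_le [Finite D] :
    6 * Nat.card (TripleOrbit v hv) ≤
      Nat.card D ^ 3 + 2 * Nat.card D + 3 * (Nat.card {a // v a = a} * Nat.card D) := by
  classical
  let := Fintype.ofFinite (TwistedTriple v hv)
  let := Fintype.ofFinite (TripleOrbit v hv)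
  have h := MulAction.sum_card_fixedBy_eq_card_orbits_mul_card_group (Equiv.Perm (Fin 3))
    (TwistedTriple v hv)
  have h6 : Fintype.card (Equiv.Perm (Fin 3)) = 6 := by decide
  rw [h6] at h
  rw [Nat.card_eq_fintype_card, mul_comm]
  calc _ = _ := by convert h.symm
    _ ≤ ∑ g : Equiv.Perm (Fin 3), if g = 1 then Nat.card D ^ 3
        else if Equiv.Perm.sign g = 1 then Nat.card D
        else Nat.card {a // v a = a} * Nat.card D := by
      refine sum_le_sum fun g _ => ?_
      rw [← Nat.card_eq_fintype_card]
      exact TwistedTriple.card_fixedBy_le g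
    _ = _ := by
      rw [sum_ite, sum_ite, sum_const, sum_const, sum_const, filter_filter, filter_filter,
        show #{g : Equiv.Perm (Fin 3) | g = 1} = 1 by decide,
        show #{g : Equiv.Perm (Fin 3) | ¬ g = 1 ∧ Equiv.Perm.sign g = 1} = 2 by decide,
        show #{g : Equiv.Perm (Fin 3) | ¬ g = 1 ∧ ¬ Equiv.Perm.sign g = 1} = 3 by decide]
      simp only [smul_eq_mul]
      ring

/-- A permutation commuting with `v`, acting on the orbits of triples. -/
def tripleOrbitMap (v : D → D) (hv : Function.Involutive v) (σ : Equiv.Perm D)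
    (hσ : ∀ a, σ (v a) = v (σ a)) : TripleOrbit v hv → TripleOrbit v hv :=
  Quotient.map (fun x => (fun i => σ (x i) : TwistedTriple v hv)) (by
    rintro x y ⟨g, rfl⟩
    refine ⟨g, ?_⟩
    funext i
    change signPow v _ (σ _) = σ (signPow v _ _)
    unfold signPow
    split_ifs
    · rfl
    · exact (hσ _).symm)

/-- The permutation of the orbits of triples induced by a permutation commuting with `v`. -/
def tripleOrbitPerm (v : D → D) (hv : Function.Involutive v) (σ : Equiv.Perm D)
    (hσ : ∀ a, σ (v a) = v (σ a)) : Equiv.Perm (TripleOrbit v hv) where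
  toFun := tripleOrbitMap v hv σ hσ
  invFun := tripleOrbitMap v hv σ.symm fun a => by
    rw [Equiv.symm_apply_eq, hσ, Equiv.apply_symm_apply]
  left_inv := by
    rintro ⟨x⟩
    exact congrArg (Quotient.mk _) (funext fun i => σ.symm_apply_apply _)
  right_inv := by
    rintro ⟨x⟩
    exact congrArg (Quotient.mk _) (funext fun i => σ.apply_symm_apply _)

/-- A permutation moving `t` points moves many orbits of triples. -/
theorem le_six_mul_card_moved [Finite D] (σ : Equiv.Perm D) (hσ : ∀ a, σ (v a) = v (σ a)) :
    Nat.card {a // σ a ≠ a} * ((Nat.card D - 2) * (Nat.card D - 3)) ≤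
      6 * Nat.card {y // tripleOrbitPerm v hv σ hσ y ≠ y} := by
  classical
  cases nonempty_fintype D
  let := Fintype.ofFinite (TwistedTriple v hv)
  let := Fintype.ofFinite (TripleOrbit v hv)
  let p : TwistedTriple v hv → TripleOrbit v hv := Quotient.mk _
  let W : Finset (TwistedTriple v hv) := univ.filter fun x => tripleOrbitPerm v hv σ hσ (p x) ≠ p x
  -- The excluded values are chosen so that, for each of the six `g`, one exclusion contradicts `g •
  -- x = σ x`; hence σ moves the orbit of such a triple.
  let S : Finset ((_ : D) × (_ : D) × D) := (univ.filter fun a => σ a ≠ a).sigma fun a =>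
    (univ \ {σ a, v (σ a)}).sigma fun b => univ \ {σ a, v (σ a), v (σ b)}
  have hS : Nat.card {a // σ a ≠ a} * ((Nat.card D - 2) * (Nat.card D - 3)) ≤ #S := by
    rw [card_sigma, Nat.card_eq_fintype_card, Fintype.card_subtype, ← smul_eq_mul, ← sum_const]
    refine sum_le_sum fun a _ => ?_
    have h2 : Nat.card D - 2 ≤ #(univ \ {σ a, v (σ a)}) := by
      refine le_trans ?_ (le_card_sdiff _ _)
      rw [card_univ, Nat.card_eq_fintype_card]
      exact Nat.sub_le_sub_left card_le_two _
    rw [card_sigma]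
    refine (Nat.mul_le_mul_right _ h2).trans ?_
    rw [← smul_eq_mul, ← sum_const]
    refine sum_le_sum fun b _ => ?_
    refine le_trans ?_ (le_card_sdiff _ _)
    rw [card_univ, Nat.card_eq_fintype_card]
    exact Nat.sub_le_sub_left card_le_three _
  have hSW : #S ≤ #W := by
    refine card_le_card_of_injOn (fun z => (![z.1, z.2.1, z.2.2] : Fin 3 → D)) ?_ ?_
    · rintro ⟨a, b, c⟩ hz
      obtain ⟨ha, hbc⟩ := mem_sigma.1 (mem_coe.1 hz)
      obtain ⟨hb, hc⟩ := mem_sigma.1 hbc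
      replace ha : σ a ≠ a := (mem_filter.1 ha).2
      replace hb : b ∉ ({σ a, v (σ a)} : Finset D) := (mem_sdiff.1 hb).2
      replace hc : c ∉ ({σ a, v (σ a), v (σ b)} : Finset D) := (mem_sdiff.1 hc).2
      simp only [mem_insert, mem_singleton, not_or] at hb hc
      obtain ⟨hb1, hb2⟩ := hb
      obtain ⟨hc1, hc2, hc3⟩ := hc
      refine mem_coe.2 (mem_filter.2 ⟨mem_univ _, fun h => ?_⟩)
      obtain ⟨g, hg⟩ := Quotient.exact h
      let x : TwistedTriple v hv := (![a, b, c] : Fin 3 → D)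
      have hg' : ∀ i, (g • x) i = σ (x i) := fun i => congrFun hg i
      have hc := TwistedTriple.smul_cases g x
      rw [hg' 0, hg' 1, hg' 2] at hc
      change ((σ a = a ∧ σ b = b ∧ σ c = c) ∨ (σ a = b ∧ σ b = c ∧ σ c = a) ∨
        (σ a = c ∧ σ b = a ∧ σ c = b)) ∨ ((σ a = v c ∧ σ b = v b ∧ σ c = v a) ∨
        (σ a = v b ∧ σ b = v a ∧ σ c = v c) ∨ (σ a = v a ∧ σ b = v c ∧ σ c = v b)) at hc
      rcases hc with (h | h | h) | (h | h | h)
      · exact ha h.1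
      · exact hb1 h.1.symm
      · exact hc1 h.1.symm
      · exact hc2 (by rw [h.1, hv])
      · exact hb2 (by rw [h.1, hv])
      · exact hc3 (by rw [h.2.1, hv])
    · rintro ⟨a, b, c⟩ _ ⟨a', b', c'⟩ _ h
      have h0 := congrFun h 0
      have h1 := congrFun h 1
      have h2 := congrFun h 2
      simp only [Matrix.cons_val] at h0 h1 h2
      subst h0 h1 h2
      rfl
  refine (hS.trans hSW).trans ?_
  rw [Nat.card_eq_fintype_card, Fintype.card_subtype]
  refine card_le_mul_card_image_of_maps_to (f := p) (fun x hx => ?_) 6 fun y _ => ?_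
  · exact mem_filter.2 ⟨mem_univ _, (mem_filter.1 hx).2⟩
  · obtain ⟨x, rfl⟩ := Quotient.exists_rep y
    have h6 : #(univ : Finset (Equiv.Perm (Fin 3))) = 6 := by decide
    rw [← h6]
    refine (card_le_card ?_).trans (card_image_le (f := fun g : Equiv.Perm (Fin 3) => g • x))
    intro z hz
    obtain ⟨g, hg⟩ := Quotient.exact (mem_filter.1 hz).2
    exact mem_image.2 ⟨g, mem_univ _, hg⟩

/-- The ternary predicates compatible with an involution and invariant under a permutation. -/
structure InvariantPred (v : D → D) (σ : Equiv.Perm D) (P : D → D → D → Prop) : Prop where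
  rotate : ∀ a b c, P a b c ↔ P b c a
  reverse : ∀ a b c, P a b c ↔ P (v c) (v b) (v a)
  map : ∀ a b c, P (σ a) (σ b) (σ c) ↔ P a b c

/-- Such a predicate is a set of cycles of the permutation τ induced on triple orbits. The number of
these cycles is at most the number of orbits minus half the number of moved orbits, and both counts
are bounded above. -/
theorem card_invariantPred_le [Finite D] (hv : Function.Involutive v) (σ : Equiv.Perm D)
    (hσ : ∀ a, σ (v a) = v (σ a)) :
    (Nat.card {P : D → D → D → Prop // InvariantPred v σ P} : ℝ) ≤
      2 ^ ((2 * ((Nat.card D : ℝ) ^ 3 + 2 * Nat.card D +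
        3 * (Nat.card {a // v a = a} * Nat.card D)) -
        Nat.card {a // σ a ≠ a} * ((Nat.card D : ℝ) - 3)) / 12) := by
  classical
  set τ := tripleOrbitPerm v hv σ hσ with hτ
  let Z := Quotient (Equiv.Perm.SameCycle.setoid τ)
  have hcard : Nat.card {P : D → D → D → Prop // InvariantPred v σ P} ≤ 2 ^ Nat.card Z := by
    have h2 : Nat.card (Z → Prop) = 2 ^ Nat.card Z := by
      rw [Nat.card_fun]; simp
    rw [← h2]
    let F : {P : D → D → D → Prop // InvariantPred v σ P} → TripleOrbit v hv → Prop := fun P =>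
      Quotient.lift (fun x : TwistedTriple v hv => P.1 (x 0) (x 1) (x 2)) (by
        rintro x y ⟨g, rfl⟩
        exact propext (TwistedTriple.pred_smul_iff P.2.rotate P.2.reverse g y))
    have hF : ∀ P y, F P (τ y) ↔ F P y := by
      rintro P ⟨x⟩
      exact P.2.map _ _ _
    have hFz : ∀ P (n : ℤ) y, F P ((τ ^ n) y) ↔ F P y := by
      intro P n
      induction n with
      | zero => intro y; rfl
      | succ n ih => intro y; rw [zpow_add_one, Equiv.Perm.mul_apply, ih, hF]
      | pred n ih =>
        intro y
        rw [zpow_sub_one, Equiv.Perm.mul_apply, ih, ← hF P (τ⁻¹ y)]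
        exact iff_of_eq (congrArg _ (τ.apply_symm_apply y))
    refine Nat.card_le_card_of_injective (fun P => Quotient.lift (F P) (by
        rintro x y ⟨n, rfl⟩
        exact propext (hFz P n x).symm) : _ → Z → Prop) fun P P' h => ?_
    apply Subtype.ext
    funext a b c
    exact congrFun h (Quotient.mk _ (Quotient.mk _ (![a, b, c] : Fin 3 → D)))
  have h1 := τ.two_mul_card_quotient_sameCycle_le
  have h2 := six_mul_card_tripleOrbit_le (v := v) (hv := hv)
  have h3 := le_six_mul_card_moved (hv := hv) σ hσ
  have h4 : Nat.card (TripleOrbit v hv) = Nat.card {y // τ y = y} + Nat.card {y // τ y ≠ y} := by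
    rw [← Nat.card_sum]
    exact Nat.card_congr (Equiv.sumCompl _).symm
  -- A saving linear in the size of D is enough later. For at most three points the truncated
  -- product is 0.
  have h5 : Nat.card D ≤ (Nat.card D - 2) * (Nat.card D - 3) + 3 := by
    generalize Nat.card D = m
    rcases Nat.lt_or_ge m 4 with h | h
    · omega
    · obtain ⟨k, rfl⟩ := Nat.exists_eq_add_of_le h
      have e1 : 4 + k - 2 = k + 2 := by omega
      have e2 : 4 + k - 3 = k + 1 := by omega
      rw [e1, e2]; nlinarith
  have h6 : (Nat.card {a // σ a ≠ a} : ℝ) * ((Nat.card D : ℝ) - 3) ≤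
      6 * Nat.card {y // τ y ≠ y} := by
    have h5' : (Nat.card D : ℝ) - 3 ≤ (((Nat.card D - 2) * (Nat.card D - 3) : ℕ) : ℝ) := by
      have : (Nat.card D : ℝ) ≤ (((Nat.card D - 2) * (Nat.card D - 3) + 3 : ℕ) : ℝ) :=
        Nat.cast_le.2 h5
      push_cast at this ⊢
      linarith
    refine (mul_le_mul_of_nonneg_left h5' (Nat.cast_nonneg _)).trans ?_
    exact_mod_cast h3
  refine (Nat.cast_le (α := ℝ).2 hcard).trans ?_
  rw [Nat.cast_pow, Nat.cast_ofNat, ← Real.rpow_natCast]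
  refine Real.rpow_le_rpow_of_exponent_le one_le_two ?_
  have h1' : (2 : ℝ) * Nat.card Z ≤ Nat.card (TripleOrbit v hv) + Nat.card {y // τ y = y} := by
    exact_mod_cast h1
  have h2' : (6 : ℝ) * Nat.card (TripleOrbit v hv) ≤
      (Nat.card D : ℝ) ^ 3 + 2 * Nat.card D + 3 * (Nat.card {a // v a = a} * Nat.card D) := by
    exact_mod_cast h2
  have h4' : (Nat.card (TripleOrbit v hv) : ℝ) =
      Nat.card {y // τ y = y} + Nat.card {y // τ y ≠ y} := by exact_mod_cast h4
  linarith

end InvariantPredicates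

/-! ### Fixed structures with prescribed units and converse -/

namespace AtomStructure

open Finset

section Fiber

variable {ι : Type*}

/-- The structures with given units and converse that are fixed by a relabelling. -/
structure InFiber (σ : Equiv.Perm ι) (I : Finset ι) (v : ι → ι) (T : AtomStructure ι) : Prop where
  regular : T.Regular
  smul_eq : σ • T = T
  unit_iff : ∀ i, T.unit i ↔ i ∈ I
  inv_eq : T.inv = v

variable {σ : Equiv.Perm ι} {I : Finset ι} {v : ι → ι} {T T' : AtomStructure ι}

namespace InFiber

theorem involutive (h : InFiber σ I v T) : Function.Involutive v := fun i => by
  rw [← h.inv_eq]; exact h.regular.inv_inv i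

theorem fix (h : InFiber σ I v T) {i : ι} (hi : i ∈ I) : v i = i := by
  rw [← h.inv_eq]; exact h.regular.inv_unit i ((h.unit_iff i).2 hi)

theorem v_mem_iff (h : InFiber σ I v T) (i : ι) : v i ∈ I ↔ i ∈ I := by
  refine ⟨fun hi => ?_, fun hi => by rwa [h.fix hi]⟩
  have := h.fix hi
  rw [h.involutive i] at this
  rwa [this]

theorem comm (h : InFiber σ I v T) (i : ι) : σ (v i) = v (σ i) := by
  have := congrFun (congrArg AtomStructure.inv h.smul_eq) (σ i)
  rwa [smul_inv, Equiv.Perm.inv_def, Equiv.symm_apply_apply, h.inv_eq] at this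

theorem map_mem_iff (h : InFiber σ I v T) (i : ι) : σ i ∈ I ↔ i ∈ I := by
  have := congrFun (congrArg AtomStructure.unit h.smul_eq) (σ i)
  rw [← h.unit_iff, ← h.unit_iff, ← this, smul_unit, Equiv.Perm.inv_def, Equiv.symm_apply_apply]

theorem map_cyc (h : InFiber σ I v T) (i j k : ι) : T.cyc (σ i) (σ j) (σ k) ↔ T.cyc i j k := by
  have := congrFun (congrFun (congrFun (congrArg AtomStructure.cyc h.smul_eq) (σ i)) (σ j)) (σ k)
  rw [← this, smul_cyc]
  simp only [Equiv.Perm.inv_def, Equiv.symm_apply_apply]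

/-- Up to rotation, a cycle containing a unit i has the form (i, j, v j), and for j a unit it occurs
exactly when i = j. Only the cycles within the complement of I and the incidences between I and its
complement are free. -/
theorem eq_of_agree (h : InFiber σ I v T) (h' : InFiber σ I v T')
    (hD : ∀ i j k, i ∉ I → j ∉ I → k ∉ I → (T.cyc i j k ↔ T'.cyc i j k))
    (hR : ∀ i j, i ∈ I → j ∉ I → (T.cyc i j (v j) ↔ T'.cyc i j (v j))) : T = T' := by
  have first : ∀ i j k, i ∈ I → (T.cyc i j k ↔ T'.cyc i j k) := by
    intro i j k hi
    by_cases hk : k = v j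
    · subst hk
      by_cases hj : j ∈ I
      · rw [h.fix hj, h.regular.unit_unit i j ((h.unit_iff i).2 hi) ((h.unit_iff j).2 hj),
          h'.regular.unit_unit i j ((h'.unit_iff i).2 hi) ((h'.unit_iff j).2 hj)]
      · exact hR i j hi hj
    · refine iff_of_false (fun hc => hk ?_) (fun hc => hk ?_)
      · rw [h.regular.unit_cyc i j k ((h.unit_iff i).2 hi) hc, h.inv_eq]
      · rw [h'.regular.unit_cyc i j k ((h'.unit_iff i).2 hi) hc, h'.inv_eq]
  refine AtomStructure.ext ?_ (h.inv_eq.trans h'.inv_eq.symm) ?_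
  · funext i; rw [h.unit_iff, h'.unit_iff]
  · funext i j k
    apply propext
    by_cases hi : i ∈ I
    · exact first i j k hi
    by_cases hj : j ∈ I
    · rw [h.regular.rotate, h'.regular.rotate]; exact first j k i hj
    by_cases hk : k ∈ I
    · rw [h.regular.rotate, h'.regular.rotate, h.regular.rotate, h'.regular.rotate]
      exact first k i j hk
    exact hD i j k hi hj hk

end InFiber

end Fiber

/-- For s = m and t = 0 the left side is m(m + 1)(m + 2)/6 = (n³ - n)/6. Each of the q atoms costs
m/2 and each of the t atoms (m - 3)/12, both at least n/24 once m ≥ 7. -/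
theorem exponent_le_of_one {n m s q t t' : ℝ} (hn : 16 ≤ n) (hm : n = m + 1) (hs : s + q ≤ m)
    (ht' : t' ≤ t) (hq : 0 ≤ q) (ht : 0 ≤ t) :
    (2 * (m ^ 3 + 2 * m + 3 * (s * m)) - t * (m - 3)) / 12 ≤
      (4 * (n ^ 3 - n) - n * (q + t')) / 24 := by
  subst hm
  have hm0 : 0 ≤ m := by linarith
  have h1 : s * m ≤ (m - q) * m := mul_le_mul_of_nonneg_right (by linarith) hm0
  have h2 : (m + 1) * t' ≤ (m + 1) * t := mul_le_mul_of_nonneg_left ht' (by linarith)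
  have h3 : 0 ≤ t * (m - 7) := mul_nonneg ht (by linarith)
  have h4 : 0 ≤ q * (11 * m - 1) := mul_nonneg hq (by linarith)
  nlinarith

/-- Passing from n - 1 to n - k diversity atoms lowers the cubic main term by at least (k - 1)n²/6.
For n ≥ 16 this pays for the k·m free incidences and for all terms of order (k - 1)n. -/
theorem exponent_le_of_two_le {n m k s q t t' : ℝ} (hn : 16 ≤ n) (hm : n = m + k) (hs : s + q ≤ m)
    (ht' : t' ≤ t + k) (hq : 0 ≤ q) (ht : 0 ≤ t) (htm : t ≤ m) (hqm : q ≤ m)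
    (hk : 2 ≤ k) (hm0 : 0 ≤ m) :
    (2 * (m ^ 3 + 2 * m + 3 * (s * m)) - t * (m - 3)) / 12 + k * m ≤
      (4 * (n ^ 3 - n) - n * ((k - 1) + q + t')) / 24 := by
  have h1 : s * m ≤ (m - q) * m := mul_le_mul_of_nonneg_right (by linarith) hm0
  have h2 : n * t' ≤ n * (t + k) := mul_le_mul_of_nonneg_left ht' (by linarith)
  have hmn : m ≤ n := by linarith
  have hkn : k ≤ n := by linarith
  have hk1 : k ≤ 2 * (k - 1) := by linarith
  have a1 : n * t ≤ m * t + 2 * (k - 1) * n := by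
    rw [hm, add_mul, ← hm]
    have : k * t ≤ (2 * (k - 1)) * n := mul_le_mul hk1 (by linarith) ht (by linarith)
    linarith
  have a2 : n * q ≤ m * q + 2 * (k - 1) * n := by
    rw [hm, add_mul, ← hm]
    have : k * q ≤ (2 * (k - 1)) * n := mul_le_mul hk1 (by linarith) hq (by linarith)
    linarith
  have a3 : k * m ≤ 2 * (k - 1) * n := mul_le_mul hk1 hmn hm0 (by linarith)
  have a4 : t ≤ (k - 1) * n := by nlinarith
  have a5 : n * k ≤ 2 * (k - 1) * n := by nlinarith
  have hcube : 4 * (n ^ 3 - n) - 4 * ((m + 1) ^ 3 - (m + 1)) ≥ 4 * ((k - 1) * n ^ 2) := by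
    have e : n - (m + 1) = k - 1 := by linarith
    have : 4 * (n ^ 3 - n) - 4 * ((m + 1) ^ 3 - (m + 1)) =
        4 * ((k - 1) * (n ^ 2 + n * (m + 1) + (m + 1) ^ 2 - 1)) := by rw [← e]; ring
    rw [this]
    have : 0 ≤ (k - 1) * (n * (m + 1) + (m + 1) ^ 2 - 1) := by
      apply mul_nonneg (by linarith)
      nlinarith
    nlinarith
  have hbig : (k - 1) * n * 64 ≤ 4 * ((k - 1) * n ^ 2) := by
    have : 0 ≤ (k - 1) * n * (n - 16) :=
      mul_nonneg (mul_nonneg (by linarith) (by linarith)) (by linarith)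
    nlinarith
  have a6 : 0 ≤ m * q := mul_nonneg hm0 hq
  have a7 : 0 ≤ m * t := mul_nonneg hm0 ht
  have a8 : 0 ≤ (k - 1) * n := mul_nonneg (by linarith) (by linarith)
  nlinarith

/-- The loss is linear in the number of extra units, of atoms moved by v and of atoms moved by σ, so
that the later sum over I, v and σ factors. -/
theorem card_inFiber_le {n : ℕ} (hn : 16 ≤ n) (σ : Equiv.Perm (Fin n)) {I : Finset (Fin n)}
    (hI : I.Nonempty) (v : Fin n → Fin n) :
    (Nat.card {T : AtomStructure (Fin n) // InFiber σ I v T} : ℝ) ≤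
      2 ^ ((4 * ((n : ℝ) ^ 3 - n) - n * (((#I - 1 : ℕ) : ℝ) + #{i | v i ≠ i} + #{i | σ i ≠ i}))
        / 24) := by
  -- A member of the fibre guarantees that I, v and σ are compatible, so that v and σ restrict to
  -- the complement of I.
  rcases isEmpty_or_nonempty {T : AtomStructure (Fin n) // InFiber σ I v T} with hE | ⟨⟨T₀, h₀⟩⟩
  · rw [Nat.card_of_isEmpty, Nat.cast_zero]; positivity
  let D := {i // i ∉ I}
  let vD : D → D := fun a => ⟨v a, fun h => a.2 ((h₀.v_mem_iff _).1 h)⟩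
  let σD : Equiv.Perm D := σ.subtypePerm fun i => not_congr (h₀.map_mem_iff i)
  have hvD : Function.Involutive vD := fun a => Subtype.ext (h₀.involutive a)
  have hσD : ∀ a, σD (vD a) = vD (σD a) := fun a => Subtype.ext (h₀.comm a)
  have main := card_invariantPred_le hvD σD hσD
  let P : {T : AtomStructure (Fin n) // InFiber σ I v T} →
      {P : D → D → D → Prop // InvariantPred vD σD P} := fun T =>
    ⟨fun a b c => T.1.cyc a b c,
      { rotate := fun a b c => T.2.regular.rotate _ _ _
        reverse := fun a b c => by
          have := T.2.regular.reverse a b c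
          rw [T.2.inv_eq] at this
          exact this
        map := fun a b c => T.2.map_cyc _ _ _ }⟩
  have hP : ∀ T T', P T = P T' → ∀ i j k, i ∉ I → j ∉ I → k ∉ I →
      (T.1.cyc i j k ↔ T'.1.cyc i j k) := fun T T' h i j k hi hj hk =>
    iff_of_eq (congrFun (congrFun (congrFun (congrArg Subtype.val h) ⟨i, hi⟩) ⟨j, hj⟩) ⟨k, hk⟩)
  have hnD : n = Nat.card D + #I := by
    have h1 : Nat.card D = #Iᶜ := by
      rw [Nat.card_eq_fintype_card, Fintype.card_subtype]
      congr 1; ext; simp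
    rw [h1, card_compl, Fintype.card_fin]
    have := card_le_univ I
    rw [Fintype.card_fin] at this
    omega
  have hsplit : ∀ f : D → D, Nat.card {a // f a = a} + Nat.card {a // f a ≠ a} = Nat.card D :=
    fun f => by
      classical
      rw [← Nat.card_sum]
      exact Nat.card_congr (Equiv.sumCompl _)
  have hq : #{i | v i ≠ i} = Nat.card {a // vD a ≠ a} := by
    rw [← Fintype.card_subtype, ← Nat.card_eq_fintype_card]
    refine Nat.card_congr
      { toFun := fun i => ⟨⟨i, fun hi => i.2 (h₀.fix hi)⟩, fun h => i.2 (congrArg Subtype.val h)⟩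
        invFun := fun a => ⟨a.1, fun h => a.2 (Subtype.ext h)⟩
        left_inv := fun i => rfl
        right_inv := fun a => rfl }
  have ht : #{i | σ i ≠ i} ≤ Nat.card {a // σD a ≠ a} + #{i ∈ I | σ i ≠ i} := by
    have h1 : #{i ∈ univ.filter (fun i => σ i ≠ i) | i ∉ I} ≤ Nat.card {a // σD a ≠ a} := by
      rw [filter_filter, ← Fintype.card_subtype, ← Nat.card_eq_fintype_card]
      refine Nat.card_le_card_of_injective
        (fun i => ⟨⟨i, i.2.2⟩, fun h => i.2.1 (congrArg Subtype.val h)⟩) fun i j h => ?_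
      exact Subtype.ext (congrArg (fun a => (a.1.1 : Fin n)) h)
    have h2 := card_filter_add_card_filter_not (s := univ.filter fun i => σ i ≠ i) (· ∈ I)
    have h3 : #{i ∈ univ.filter (fun i => σ i ≠ i) | i ∈ I} ≤ #{i ∈ I | σ i ≠ i} := by
      refine card_le_card fun i hi => ?_
      simp only [mem_filter, mem_univ, true_and] at hi ⊢
      exact hi.symm
    omega
  have hsv := hsplit vD
  have hsσ := hsplit σD
  have hn' : (16 : ℝ) ≤ n := by exact_mod_cast hn
  have hnD' : (n : ℝ) = Nat.card D + #I := by exact_mod_cast hnD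
  have hs' : (Nat.card {a // vD a = a} : ℝ) + #{i | v i ≠ i} ≤ Nat.card D := by
    rw [hq]; exact_mod_cast hsv.le
  have hk := hI.card_pos
  rcases (Nat.succ_le_of_lt hk).eq_or_lt with h1 | h2
  · obtain ⟨e, rfl⟩ := card_eq_one.1 h1.symm
    have hle : Nat.card {T : AtomStructure (Fin n) // InFiber σ {e} v T} ≤
        Nat.card {P : D → D → D → Prop // InvariantPred vD σD P} := by
      refine Nat.card_le_card_of_injective P fun T T' h => ?_
      refine Subtype.ext (T.2.eq_of_agree T'.2 (hP T T' h) fun i j hi hj => ?_)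
      -- A single unit must serve every atom, so no incidence is free.
      have key : ∀ T : AtomStructure (Fin n), InFiber σ {e} v T → T.cyc i j (v j) := by
        intro T hT
        obtain ⟨i', hi', hc⟩ := hT.regular.exists_unit j
        rw [hT.unit_iff, mem_singleton] at hi'
        rw [mem_singleton] at hi
        rw [hi, ← hi', ← hT.inv_eq]
        exact hc
      exact iff_of_true (key T.1 T.2) (key T'.1 T'.2)
    refine (Nat.cast_le.2 hle).trans (main.trans ?_)
    refine Real.rpow_le_rpow_of_exponent_le one_le_two ?_
    have hfix : σ e = e := mem_singleton.1 ((h₀.map_mem_iff e).2 (mem_singleton_self e))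
    have h0 : #{i ∈ ({e} : Finset (Fin n)) | σ i ≠ i} = 0 := by
      rw [card_eq_zero, filter_eq_empty_iff]
      intro i hi
      rw [mem_singleton] at hi
      rw [hi]; simpa using hfix
    rw [h0, add_zero] at ht
    have := exponent_le_of_one hn' (by simpa using hnD') hs'
      (Nat.cast_le (α := ℝ).2 ht) (Nat.cast_nonneg _) (Nat.cast_nonneg _)
    simpa using this
  · have hle : Nat.card {T : AtomStructure (Fin n) // InFiber σ I v T} ≤
        Nat.card {P : D → D → D → Prop // InvariantPred vD σD P} * 2 ^ (#I * Nat.card D) := by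
      have h2 : Nat.card (I × D → Prop) = 2 ^ (#I * Nat.card D) := by
        rw [Nat.card_fun, Nat.card_prod]; simp
      rw [← h2, ← Nat.card_prod]
      refine Nat.card_le_card_of_injective
        (fun T => (P T, fun p => T.1.cyc p.1 p.2 (v p.2))) fun T T' h => ?_
      rw [Prod.mk.injEq] at h
      exact Subtype.ext (T.2.eq_of_agree T'.2 (hP T T' h.1) fun i j hi hj =>
        iff_of_eq (congrFun h.2 (⟨i, hi⟩, ⟨j, hj⟩)))
    refine (Nat.cast_le (α := ℝ).2 hle).trans ?_
    rw [Nat.cast_mul, Nat.cast_pow, Nat.cast_ofNat]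
    refine (mul_le_mul_of_nonneg_right main (by positivity)).trans ?_
    rw [← Real.rpow_natCast 2 (#I * Nat.card D), ← Real.rpow_add two_pos]
    refine Real.rpow_le_rpow_of_exponent_le one_le_two ?_
    -- Here σ may also permute the units, at most `#I` of them.
    have htI : #{i | σ i ≠ i} ≤ Nat.card {a // σD a ≠ a} + #I :=
      ht.trans (Nat.add_le_add_left (card_filter_le _ _) _)
    rw [Nat.cast_mul, Nat.cast_sub hk, Nat.cast_one]
    refine exponent_le_of_two_le hn' hnD' hs' (by exact_mod_cast htI) (Nat.cast_nonneg _)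
      (Nat.cast_nonneg _) (by exact_mod_cast (Nat.le_add_left _ _).trans hsσ.le) ?_
      (by exact_mod_cast h2) (Nat.cast_nonneg _)
    rw [hq]; exact_mod_cast (Nat.le_add_left _ _).trans hsv.le

/-! ### Isomorphism classes, orbits and Burnside's lemma -/

/-- The atom structures of the finite algebras with atoms labelled by `Fin n`. -/
def realizable (n : ℕ) : SubMulAction (Equiv.Perm (Fin n)) (AtomStructure (Fin n)) where
  carrier := {T | ∃ A : FinNA, ∃ e : Fin n ≃ {a : A // IsAtom a}, ofLabel e = T}
  smul_mem' := by
    rintro σ _ ⟨A, e, rfl⟩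
    exact ⟨A, _, (smul_ofLabel e σ).symm⟩

instance (n : ℕ) : Finite (realizable n) :=
  inferInstanceAs (Finite {T // T ∈ realizable n})

theorem regular_of_mem_realizable {n : ℕ} {T : AtomStructure (Fin n)} (h : T ∈ realizable n) :
    T.Regular := by
  obtain ⟨A, e, rfl⟩ := h
  exact regular_ofLabel e

end AtomStructure

namespace FinNA

open AtomStructure

theorem exists_label (A : FinNA) : Nonempty (Fin A.atomCount ≃ {a : A // IsAtom a}) :=
  ⟨(Finite.equivFinOfCardEq (Nat.card_coe_set_eq _)).symm⟩

/-- One algebra is chosen per orbit. Any labelling of another algebra can be permuted to the chosen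
representative, and equal atom structures give isomorphic algebras. -/
theorem exists_isoClasses_subset_range (n : ℕ) :
    ∃ g : MulAction.orbitRel.Quotient (Equiv.Perm (Fin n)) (realizable n) → Quotient isoSetoid,
      {c : Quotient isoSetoid | ∃ A : FinNA, A.atomCount = n ∧ ⟦A⟧ = c} ⊆ Set.range g := by
  classical
  have hA : ∀ q : MulAction.orbitRel.Quotient (Equiv.Perm (Fin n)) (realizable n),
      ∃ A : FinNA, ∃ e : Fin n ≃ {a : A // IsAtom a}, ofLabel e = (q.out : realizable n).1 :=
    fun q => (q.out : realizable n).2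
  choose A e he using hA
  refine ⟨fun q => ⟦A q⟧, ?_⟩
  rintro _ ⟨B, rfl, rfl⟩
  obtain ⟨f⟩ := B.exists_label
  let T : realizable B.atomCount := ⟨ofLabel f, B, f, rfl⟩
  let q : MulAction.orbitRel.Quotient (Equiv.Perm (Fin B.atomCount)) (realizable B.atomCount) :=
    Quotient.mk _ T
  refine ⟨q, Quotient.sound ?_⟩
  obtain ⟨σ, hσ⟩ : (q.out : realizable B.atomCount) ∈
      MulAction.orbit (Equiv.Perm (Fin B.atomCount)) T := Quotient.exact (Quotient.out_eq q)
  have h1 : σ • ofLabel f = ofLabel (e q) := (congrArg Subtype.val hσ).trans (he q).symm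
  rw [smul_ofLabel] at h1
  exact nonempty_iso_of_ofLabel_eq (e q) _ h1.symm

theorem finite_isoClasses (n : ℕ) :
    {c : Quotient isoSetoid | ∃ A : FinNA, A.atomCount = n ∧ ⟦A⟧ = c}.Finite := by
  obtain ⟨g, hg⟩ := exists_isoClasses_subset_range n
  exact (Set.finite_range g).subset hg

theorem numIsoClasses_mul_factorial_le (n : ℕ) (P : FinNA → Prop) :
    numIsoClasses n P * n ! ≤
      ∑ σ : Equiv.Perm (Fin n), Nat.card (MulAction.fixedBy (realizable n) σ) := by
  classical
  let := Fintype.ofFinite (realizable n)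
  let := Fintype.ofFinite (MulAction.orbitRel.Quotient (Equiv.Perm (Fin n)) (realizable n))
  have h := MulAction.sum_card_fixedBy_eq_card_orbits_mul_card_group (Equiv.Perm (Fin n))
    (realizable n)
  rw [Fintype.card_perm, Fintype.card_fin] at h
  simp only [Nat.card_eq_fintype_card]
  rw [h]
  refine Nat.mul_le_mul_right _ ?_
  obtain ⟨g, hg⟩ := exists_isoClasses_subset_range n
  refine (Set.ncard_le_ncard (t := Set.range g) ?_ (Set.finite_range g)).trans ?_
  · rintro c ⟨A, hA, _, hc⟩
    exact hg ⟨A, hA, hc⟩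
  · rw [← Nat.card_coe_set_eq]
    refine (Finite.card_range_le g).trans (le_of_eq ?_)
    rw [Nat.card_eq_fintype_card]

end FinNA

/-! ### Generating sums for unit sets, converses and relabellings -/

section Sums

open Finset

theorem sum_fun_pow_card_moved (n : ℕ) (x : ℝ) :
    ∑ v : Fin n → Fin n, x ^ #{i | v i ≠ i} = (1 + (n - 1) * x) ^ n := by
  have h1 : ∀ v : Fin n → Fin n, x ^ #{i | v i ≠ i} = ∏ i, if v i = i then 1 else x := by
    intro v
    rw [prod_ite, prod_const_one, one_mul, prod_const]
  simp_rw [h1]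
  rw [← Fintype.prod_sum fun i j : Fin n => if j = i then (1 : ℝ) else x]
  have h2 : ∀ i : Fin n, ∑ j : Fin n, (if j = i then (1 : ℝ) else x) = 1 + (n - 1) * x := by
    intro i
    rw [sum_ite, sum_const, sum_const, filter_eq' univ i, if_pos (mem_univ i), card_singleton,
      filter_ne' univ i, card_erase_of_mem (mem_univ i), card_univ, Fintype.card_fin,
      nsmul_eq_mul, nsmul_eq_mul, Nat.cast_sub (i.pos)]
    simp
  simp [h2]

theorem sum_perm_pow_card_moved_le (n : ℕ) {x : ℝ} (hx : 0 ≤ x) :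
    ∑ σ : Equiv.Perm (Fin n), x ^ #{i | σ i ≠ i} ≤ (1 + (n - 1) * x) ^ n := by
  rw [← sum_fun_pow_card_moved]
  let j : Equiv.Perm (Fin n) ↪ (Fin n → Fin n) := ⟨fun σ => σ, Equiv.coe_fn_injective⟩
  rw [show ∑ σ : Equiv.Perm (Fin n), x ^ #{i | σ i ≠ i} =
    ∑ v ∈ univ.map j, x ^ #{i | v i ≠ i} from
      (sum_map univ j fun v => x ^ #{i | v i ≠ i}).symm]
  exact sum_le_univ_sum_of_nonneg fun v => pow_nonneg hx _

/-- The sum equals ((1 + x)^n - 1)/x. The factor n is the number of singletons I, which dominate for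
small x. -/
theorem sum_nonempty_pow_card_sub_one_le (n : ℕ) {x : ℝ} (hx : 0 < x) :
    ∑ I : Finset (Fin n) with I.Nonempty, x ^ (#I - 1) ≤ n * (1 + x) ^ n := by
  have h1 : ∑ I : Finset (Fin n), x ^ #I = (1 + x) ^ n := by
    have := Finset.prod_one_add (f := fun _ : Fin n => x) univ
    simpa using this.symm
  have h2 : ∑ I : Finset (Fin n), x ^ #I =
      1 + x * ∑ I : Finset (Fin n) with I.Nonempty, x ^ (#I - 1) := by
    rw [← sum_filter_add_sum_filter_not univ (fun I : Finset (Fin n) => I.Nonempty), add_comm,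
      mul_sum]
    congr 1
    · simp [not_nonempty_iff_eq_empty, filter_eq']
    · refine sum_congr rfl fun I hI => ?_
      rw [← pow_succ', Nat.sub_add_cancel (mem_filter.1 hI).2.card_pos]
  have h3 : ∀ k : ℕ, (1 + x) ^ k ≤ 1 + k * x * (1 + x) ^ k := by
    intro k
    induction k with
    | zero => simp
    | succ k ih =>
      have : (k + 1) * x * (1 + x) ^ k ≤ (k + 1) * x * (1 + x) ^ (k + 1) := by
        refine mul_le_mul_of_nonneg_left (pow_le_pow_right₀ (by linarith) (Nat.le_succ k)) ?_
        positivity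
      rw [Nat.cast_succ]
      have e : (1 + x) ^ (k + 1) = (1 + x) ^ k + x * (1 + x) ^ k := by ring
      nlinarith
  refine le_of_mul_le_mul_left ?_ hx
  linarith [h3 n]

end Sums

/-! ### Assembling the upper bound -/

namespace AtomStructure

open Finset

theorem card_fixedBy_le_sum {n : ℕ} (hn : 0 < n) (σ : Equiv.Perm (Fin n)) :
    Nat.card (MulAction.fixedBy (realizable n) σ) ≤
      ∑ I : Finset (Fin n) with I.Nonempty, ∑ v : Fin n → Fin n,
        Nat.card {T : AtomStructure (Fin n) // InFiber σ I v T} := by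
  classical
  let p : MulAction.fixedBy (realizable n) σ → Finset (Fin n) × (Fin n → Fin n) := fun T =>
    (univ.filter fun i => T.1.1.unit i, T.1.1.inv)
  let := Fintype.ofFinite (MulAction.fixedBy (realizable n) σ)
  rw [← sum_product', Nat.card_eq_fintype_card, ← card_univ,
    card_eq_sum_card_fiberwise (f := p)
      (t := (univ.filter fun I : Finset (Fin n) => I.Nonempty) ×ˢ univ)]
  · refine sum_le_sum fun q _ => ?_
    rw [← Fintype.card_subtype, ← Nat.card_eq_fintype_card]
    refine Nat.card_le_card_of_injective (fun T => ⟨T.1.1.1,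
      { regular := regular_of_mem_realizable T.1.1.2
        smul_eq := congrArg Subtype.val T.1.2
        unit_iff := fun i => by
          rw [← congrArg Prod.fst T.2]
          simp [p]
        inv_eq := congrArg Prod.snd T.2 }⟩) fun T T' h => ?_
    exact Subtype.ext (Subtype.ext (Subtype.ext (Subtype.mk.inj h)))
  · intro T _
    obtain ⟨i, hi, _⟩ := (regular_of_mem_realizable T.1.2).exists_unit ⟨0, hn⟩
    simp only [coe_product, Set.mem_prod, mem_coe, mem_filter, mem_univ, true_and, and_true, p]
    exact ⟨i, by simpa using hi⟩

end AtomStructure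

open Finset AtomStructure in
/-- The upper bound: every isomorphism class, weighted by `n!`. -/
theorem FinNA.numIsoClasses_mul_factorial_le_real {n : ℕ} (hn : 16 ≤ n) (P : FinNA → Prop)
    {x : ℝ} (hx : x = 2 ^ (-(n : ℝ) / 24)) :
    (numIsoClasses n P : ℝ) * n ! ≤
      2 ^ cycleCountQ n n * (n * (1 + x) ^ n) * ((1 + (n - 1) * x) ^ n) ^ 2 := by
  have hx0 : 0 < x := hx ▸ Real.rpow_pos_of_pos two_pos _
  have hQ : (2 : ℝ) ^ cycleCountQ n n = 2 ^ (4 * ((n : ℝ) ^ 3 - n) / 24) := by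
    rw [← Real.rpow_natCast]
    congr 1
    have : (6 * cycleCountQ n n + n : ℝ) = (n : ℝ) ^ 3 := by
      exact_mod_cast six_mul_cycleCountQ_self n
    linarith
  have hpow : ∀ k : ℕ, x ^ k = 2 ^ (-(n : ℝ) * k / 24) := fun k => by
    rw [hx, ← Real.rpow_mul_natCast two_pos.le]
    congr 1; ring
  have hfib : ∀ (σ : Equiv.Perm (Fin n)) (I : Finset (Fin n)), I.Nonempty → ∀ v,
      (Nat.card {T : AtomStructure (Fin n) // InFiber σ I v T} : ℝ) ≤
      2 ^ cycleCountQ n n * x ^ (#I - 1) * x ^ #{i | v i ≠ i} * x ^ #{i | σ i ≠ i} := by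
    intro σ I hI v
    refine (card_inFiber_le hn σ hI v).trans (le_of_eq ?_)
    rw [hQ, hpow, hpow, hpow, ← Real.rpow_add two_pos, ← Real.rpow_add two_pos,
      ← Real.rpow_add two_pos]
    congr 1; ring
  calc (numIsoClasses n P : ℝ) * n !
      ≤ ∑ σ : Equiv.Perm (Fin n), (Nat.card (MulAction.fixedBy (realizable n) σ) : ℝ) := by
        exact_mod_cast numIsoClasses_mul_factorial_le n P
    _ ≤ ∑ σ : Equiv.Perm (Fin n), ∑ I : Finset (Fin n) with I.Nonempty, ∑ v : Fin n → Fin n,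
        2 ^ cycleCountQ n n * x ^ (#I - 1) * x ^ #{i | v i ≠ i} * x ^ #{i | σ i ≠ i} := by
        refine sum_le_sum fun σ _ => ?_
        refine (Nat.cast_le (α := ℝ).2 (card_fixedBy_le_sum (by omega) σ)).trans ?_
        push_cast
        exact sum_le_sum fun I hI => sum_le_sum fun v _ => hfib σ I (mem_filter.1 hI).2 v
    _ = 2 ^ cycleCountQ n n * (∑ I : Finset (Fin n) with I.Nonempty, x ^ (#I - 1)) *
        ((∑ v : Fin n → Fin n, x ^ #{i | v i ≠ i}) *
          ∑ σ : Equiv.Perm (Fin n), x ^ #{i | σ i ≠ i}) := by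
        simp only [← mul_sum, ← sum_mul]
        ring
    _ ≤ _ := by
        rw [sq]
        have h0 : 0 ≤ 1 + ((n : ℝ) - 1) * x := by
          have : (1 : ℝ) ≤ n := by exact_mod_cast (by omega : 1 ≤ n)
          have := mul_nonneg (sub_nonneg.2 this) hx0.le
          linarith
        refine mul_le_mul ?_ ?_ ?_ (by positivity)
        · exact mul_le_mul_of_nonneg_left (sum_nonempty_pow_card_sub_one_le n hx0) (by positivity)
        · rw [sum_fun_pow_card_moved]
          exact mul_le_mul_of_nonneg_left (sum_perm_pow_card_moved_le n hx0.le) (pow_nonneg h0 _)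
        · exact mul_nonneg (sum_nonneg fun _ _ => pow_nonneg hx0.le _)
            (sum_nonneg fun _ _ => pow_nonneg hx0.le _)

/-! ### Symmetric algebras built from sets of 3-element multisets -/

section SymmetricAlgebra

open NonassocRelAlgebra AtomStructure

variable {α : Type*}

/-- The multiset `{a, b, c}`. -/
def symTriple (a b c : α) : Sym α 3 := a ::ₛ b ::ₛ c ::ₛ Sym.nil

theorem symTriple_swap_left (a b c : α) : symTriple a b c = symTriple b a c :=
  Sym.cons_swap _ _ _

theorem symTriple_swap_right (a b c : α) : symTriple a b c = symTriple a c b :=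
  congrArg (a ::ₛ ·) (Sym.cons_swap _ _ _)

theorem mem_symTriple {x a b c : α} : x ∈ symTriple a b c ↔ x = a ∨ x = b ∨ x = c := by
  simp [symTriple]

theorem exists_eq_symTriple (s : Sym α 3) : ∃ a b c, s = symTriple a b c := by
  obtain ⟨a, s, rfl⟩ := s.exists_eq_cons_of_succ
  obtain ⟨b, s, rfl⟩ := s.exists_eq_cons_of_succ
  obtain ⟨c, s, rfl⟩ := s.exists_eq_cons_of_succ
  exact ⟨a, b, c, by rw [Sym.eq_nil_of_card_zero s]; rfl⟩

/-- The cycles of the symmetric atom structure with the identity atom `none` whose cycles of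
diversity atoms are given by `T`. -/
def symCycle (T : Finset (Sym α 3)) : Option α → Option α → Option α → Prop
  | none, b, c => b = c
  | some a, none, c => some a = c
  | some a, some b, none => a = b
  | some a, some b, some c => symTriple a b c ∈ T

variable {T : Finset (Sym α 3)}

theorem symCycle_none_left (b c : Option α) : symCycle T none b c ↔ b = c := Iff.rfl

theorem symCycle_swap (a b c : Option α) : symCycle T a b c ↔ symCycle T b a c := by
  rcases a with _ | a <;> rcases b with _ | b <;> rcases c with _ | c <;>
    simp [symCycle, eq_comm, symTriple_swap_left]

theorem symCycle_rotate (a b c : Option α) : symCycle T a b c ↔ symCycle T b c a := by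
  rcases a with _ | a <;> rcases b with _ | b <;> rcases c with _ | c <;>
    simp only [symCycle, reduceCtorEq, Option.some.injEq, eq_comm]
  rw [symTriple_swap_left a, symTriple_swap_right b]

theorem symCycle_none_mid (a c : Option α) : symCycle T a none c ↔ a = c := by
  rw [symCycle_swap, symCycle_none_left]

theorem symCycle_none_right (a b : Option α) : symCycle T a b none ↔ a = b := by
  rw [← symCycle_rotate, symCycle_none_left]

/-- The condition that makes the symmetric algebra given by `T` associative. -/
def Linked (T : Finset (Sym α 3)) : Prop :=
  ∀ a b c d, ∃ x, symTriple a b x ∈ T ∧ symTriple x c d ∈ T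

/-- If one of the four atoms is the identity, both sides agree for every T; otherwise linkedness
makes both sides true. -/
theorem Linked.symCycle_assoc (hT : Linked T) (a b c d : Option α) :
    (∃ x, symCycle T a b x ∧ symCycle T x c d) ↔ ∃ y, symCycle T b c y ∧ symCycle T a y d := by
  rcases a with _ | a
  · simp [symCycle_none_left]
  rcases b with _ | b
  · simp [symCycle_none_left, symCycle_none_mid]
  rcases c with _ | c
  · simp [symCycle_none_mid]
  rcases d with _ | d
  · simp only [symCycle_none_right, exists_eq_right, exists_eq_right']
    exact symCycle_rotate _ _ _
  · refine iff_of_true ?_ ?_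
    · obtain ⟨x, h⟩ := hT a b c d
      exact ⟨some x, h⟩
    · obtain ⟨y, h1, h2⟩ := hT b c a d
      rw [symTriple_swap_left] at h2
      exact ⟨some y, h1, h2⟩

/-- The algebra of all subsets of the symmetric atom structure given by `T`. -/
@[reducible] def symAlgebraStr (T : Finset (Sym α 3)) : NonassocRelAlgebra (Set (Option α)) :=
  { (inferInstance : BooleanAlgebra (Set (Option α))) with
    mul := fun X Y => {c | ∃ a ∈ X, ∃ b ∈ Y, symCycle T a b c}
    one := {none}
    one_mul := fun X => by
      ext c
      change (∃ a ∈ ({none} : Set (Option α)), ∃ b ∈ X, symCycle T a b c) ↔ c ∈ X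
      simp [symCycle_none_left]
    mul_one := fun X => by
      ext c
      change (∃ a ∈ X, ∃ b ∈ ({none} : Set (Option α)), symCycle T a b c) ↔ c ∈ X
      simp [symCycle_none_mid]
    conv := id
    triangle_left := fun X Y Z => by
      change ({c | ∃ a ∈ X, ∃ b ∈ Y, symCycle T a b c} ∩ Z = ∅) ↔
        ({c | ∃ a ∈ X, ∃ b ∈ Z, symCycle T a b c} ∩ Y = ∅)
      simp only [Set.eq_empty_iff_forall_notMem, Set.mem_inter_iff, Set.mem_ofPred_eq, not_and]
      constructor
      · rintro h b ⟨a, ha, c, hc, hab⟩ hb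
        refine h c ⟨a, ha, b, hb, ?_⟩ hc
        rwa [symCycle_swap, symCycle_rotate]
      · rintro h c ⟨a, ha, b, hb, hab⟩ hc
        refine h b ⟨a, ha, c, hc, ?_⟩ hb
        rwa [symCycle_swap, symCycle_rotate]
    triangle_right := fun X Y Z => by
      change ({c | ∃ a ∈ X, ∃ b ∈ Z, symCycle T a b c} ∩ Y = ∅) ↔
        ({c | ∃ a ∈ Z, ∃ b ∈ Y, symCycle T a b c} ∩ X = ∅)
      simp only [Set.eq_empty_iff_forall_notMem, Set.mem_inter_iff, Set.mem_ofPred_eq, not_and]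
      constructor
      · rintro h a ⟨c, hc, b, hb, hab⟩ ha
        refine h b ⟨a, ha, c, hc, ?_⟩ hb
        rwa [symCycle_rotate]
      · rintro h b ⟨a, ha, c, hc, hab⟩ hb
        refine h a ⟨c, hc, b, hb, ?_⟩ ha
        rwa [← symCycle_rotate] }

variable {m : ℕ}

/-- The symmetric algebra with `m` diversity atoms given by `T`. -/
def symAlgebra (T : Finset (Sym (Fin m) 3)) : FinNA :=
  letI := symAlgebraStr T
  { carrier := Set (Option (Fin m)) }

theorem symAlgebra_isSymmetric (T : Finset (Sym (Fin m) 3)) : (symAlgebra T).IsSymmetric :=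
  fun _ => rfl

theorem symAlgebra_identityIsAtom (T : Finset (Sym (Fin m) 3)) :
    (symAlgebra T).IdentityIsAtom :=
  Set.isAtom_singleton (none : Option (Fin m))

theorem Linked.symAlgebra_isAssociative {T : Finset (Sym (Fin m) 3)} (hT : Linked T) :
    (symAlgebra T).IsAssociative := by
  intro X Y Z
  change Set (Option (Fin m)) at X Y Z
  apply Set.ext
  intro d
  change (∃ x ∈ {x | ∃ a ∈ X, ∃ b ∈ Y, symCycle T a b x}, ∃ c ∈ Z, symCycle T x c d) ↔
    (∃ a ∈ X, ∃ y ∈ {y | ∃ b ∈ Y, ∃ c ∈ Z, symCycle T b c y}, symCycle T a y d)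
  constructor
  · rintro ⟨x, ⟨a, ha, b, hb, hx⟩, c, hc, hd⟩
    obtain ⟨y, h1, h2⟩ := (hT.symCycle_assoc a b c d).1 ⟨x, hx, hd⟩
    exact ⟨a, ha, y, ⟨b, hb, c, hc, h1⟩, h2⟩
  · rintro ⟨a, ha, y, ⟨b, hb, c, hc, hy⟩, hd⟩
    obtain ⟨x, h1, h2⟩ := (hT.symCycle_assoc a b c d).2 ⟨y, hy, hd⟩
    exact ⟨x, ⟨a, ha, b, hb, h1⟩, c, hc, h2⟩

/-- The labelling of the atoms of `symAlgebra T` by `Option (Fin m)`. -/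
noncomputable def symLabel (T : Finset (Sym (Fin m) 3)) :
    Option (Fin m) ≃ {a : symAlgebra T // IsAtom a} :=
  Equiv.ofBijective (fun i => ⟨({i} : Set (Option (Fin m))), Set.isAtom_singleton i⟩)
    ⟨fun _ _ h => Set.singleton_injective (congrArg Subtype.val h), fun a => by
      obtain ⟨i, hi⟩ := Set.isAtom_iff.1 a.2
      exact ⟨i, Subtype.ext hi.symm⟩⟩

theorem symAlgebra_atomCount (T : Finset (Sym (Fin m) 3)) :
    (symAlgebra T).atomCount = m + 1 := by
  rw [FinNA.atomCount, ← Nat.card_coe_set_eq]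
  exact (Nat.card_congr (symLabel T).symm).trans (by simp)

theorem unit_symLabel (T : Finset (Sym (Fin m) 3)) (i : Option (Fin m)) :
    (ofLabel (symLabel T)).unit i ↔ i = none :=
  Set.singleton_subset_singleton

theorem cyc_symLabel (T : Finset (Sym (Fin m) 3)) (i j k : Option (Fin m)) :
    (ofLabel (symLabel T)).cyc i j k ↔ symCycle T i j k := by
  change (¬ ({c | ∃ a ∈ ({i} : Set (Option (Fin m))), ∃ b ∈ ({j} : Set (Option (Fin m))),
    symCycle T a b c} ∩ ({k} : Set (Option (Fin m))) = ∅)) ↔ _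
  rw [← Ne, ← Set.nonempty_iff_ne_empty, Set.inter_singleton_nonempty]
  simp

/-- Isomorphic symmetric algebras arise from each other by permuting the diversity atoms. -/
theorem exists_perm_of_symAlgebra_equiv {T T₀ : Finset (Sym (Fin m) 3)}
    (h : symAlgebra T ≈ symAlgebra T₀) :
    ∃ p : Equiv.Perm (Fin m), ∀ s, s ∈ T ↔ s.map p ∈ T₀ := by
  obtain ⟨u⟩ := h
  obtain ⟨f, hf⟩ := exists_ofLabel_eq_of_iso u (symLabel T)
  let r : Equiv.Perm (Option (Fin m)) := f.trans (symLabel T₀).symm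
  have hfr : f = r.trans (symLabel T₀) := by ext; simp [r]
  have hunit : ∀ i, (ofLabel f).unit i ↔ (ofLabel (symLabel T₀)).unit (r i) := fun i => by
    rw [hfr]; rfl
  have hcyc : ∀ i j k, (ofLabel f).cyc i j k ↔
      (ofLabel (symLabel T₀)).cyc (r i) (r j) (r k) := fun i j k => by
    rw [hfr]; rfl
  rw [hf] at hunit hcyc
  simp only [unit_symLabel] at hunit
  simp only [cyc_symLabel] at hcyc
  -- `none` is the only unit on either side, so the relabelling restricts to the diversity atoms.
  have hnone : r none = none := (hunit none).1 rfl
  have hsome : ∀ i, r (some i) = some (Equiv.removeNone r i) := fun i => by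
    rw [Equiv.removeNone_some]
    rcases hi : r (some i) with _ | j
    · exact absurd (r.injective (hi.trans hnone.symm)) (by simp)
    · exact ⟨j, rfl⟩
  refine ⟨Equiv.removeNone r, fun s => ?_⟩
  obtain ⟨a, b, c, rfl⟩ := exists_eq_symTriple s
  have := hcyc (some a) (some b) (some c)
  rw [hsome, hsome, hsome] at this
  rwa [show (symTriple a b c).map (Equiv.removeNone r) = symTriple (Equiv.removeNone r a)
    (Equiv.removeNone r b) (Equiv.removeNone r c) from rfl]

end SymmetricAlgebra

/-! ### Most choices of cycles are linked -/

section Counting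

open Finset

/-- Among the subsets of a finite set, those containing none of the given disjoint pairs. -/
theorem card_avoiding_pairs_le {Y κ : Type*} [Fintype Y] [DecidableEq Y] [DecidableEq κ]
    (p q : κ → Y) (X : Finset κ)
    (h : ∀ x ∈ X, ∀ y ∈ X, x ≠ y → p x ≠ p y ∧ p x ≠ q y ∧ q x ≠ q y) :
    4 ^ #X * #{T : Finset Y | ∀ x ∈ X, ¬ (p x ∈ T ∧ q x ∈ T)} ≤
      3 ^ #X * 2 ^ Fintype.card Y := by
  induction X using Finset.induction_on with
  | empty => simp
  | insert x X hx ih =>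
    have ih := ih fun y hy z hz => h y (mem_insert_of_mem hy) z (mem_insert_of_mem hz)
    set S : Finset (Finset Y) := {T | ∀ x ∈ X, ¬ (p x ∈ T ∧ q x ∈ T)} with hS
    have hsplit := card_filter_add_card_filter_not (s := S) fun T => p x ∈ T ∧ q x ∈ T
    have hins : ({T : Finset Y | ∀ y ∈ insert x X, ¬ (p y ∈ T ∧ q y ∈ T)} : Finset (Finset Y)) =
        S.filter fun T => ¬ (p x ∈ T ∧ q x ∈ T) := by
      ext T
      simp only [hS, mem_filter, mem_univ, true_and, forall_mem_insert]
      exact and_comm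
    -- At least a quarter of `S` contains the new pair: adding both elements stays in `S`, since the
    -- other pairs are disjoint from it, and two bits recover `T`.
    have hB : #S ≤ #(S.filter fun T => p x ∈ T ∧ q x ∈ T) * 4 := by
      rw [show 4 = #(univ : Finset (Bool × Bool)) from rfl, ← card_product]
      refine card_le_card_of_injOn
        (fun T => (T ∪ {p x, q x}, (decide (p x ∈ T), decide (q x ∈ T)))) ?_ ?_
      · intro T hT
        have hT := (mem_filter.1 (mem_coe.1 hT)).2
        refine mem_coe.2 (mem_product.2 ⟨mem_filter.2 ⟨mem_filter.2 ⟨mem_univ _, ?_⟩, ?_⟩,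
          mem_univ _⟩)
        · intro y hy hpq
          have hxy : x ≠ y := fun e => hx (e ▸ hy)
          have h1 := h x (mem_insert_self _ _) y (mem_insert_of_mem hy) hxy
          have h2 := h y (mem_insert_of_mem hy) x (mem_insert_self _ _) hxy.symm
          refine hT y hy ⟨?_, ?_⟩
          · have := hpq.1
            simp only [mem_union, mem_insert, mem_singleton] at this
            exact this.resolve_right (not_or.2 ⟨h2.1, h2.2.1⟩)
          · have := hpq.2
            simp only [mem_union, mem_insert, mem_singleton] at this
            exact this.resolve_right (not_or.2 ⟨h1.2.1.symm, h2.2.2⟩)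
        · simp
      · intro T _ T' _ hTT
        simp only [Prod.mk.injEq, decide_eq_decide] at hTT
        ext y
        by_cases h1 : y = p x
        · rw [h1]; exact hTT.2.1
        by_cases h2 : y = q x
        · rw [h2]; exact hTT.2.2
        have := congrArg (y ∈ ·) hTT.1
        simpa [h1, h2] using this
    rw [hins, card_insert_of_notMem hx, pow_succ, pow_succ]
    have h1 : 4 * #(S.filter fun T => ¬ (p x ∈ T ∧ q x ∈ T)) ≤ 3 * #S := by omega
    calc _ = 4 ^ #X * (4 * #(S.filter fun T => ¬ (p x ∈ T ∧ q x ∈ T))) := by ring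
      _ ≤ 4 ^ #X * (3 * #S) := Nat.mul_le_mul_left _ h1
      _ = 3 * (4 ^ #X * #S) := by ring
      _ ≤ 3 * (3 ^ #X * 2 ^ Fintype.card Y) := Nat.mul_le_mul_left _ ih
      _ = _ := by ring

theorem card_sym_three (m : ℕ) : Fintype.card (Sym (Fin m) 3) = cycleCountQ (m + 1) (m + 1) := by
  rw [Sym.card_sym_eq_multichoose, Fintype.card_fin, Nat.multichoose_eq]
  have h1 := six_mul_cycleCountQ_self (m + 1)
  have h2 := Nat.descFactorial_eq_factorial_mul_choose (m + 3 - 1) 3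
  simp only [Nat.descFactorial, Nat.factorial] at h2
  have e : (m + 3 - 1 - 2) * ((m + 3 - 1 - 1) * ((m + 3 - 1 - 0) * 1)) = m * ((m + 1) * (m + 2)) := by
    simp
  rw [e] at h2
  have e2 : m * ((m + 1) * (m + 2)) + (m + 1) = (m + 1) ^ 3 := by ring
  omega

theorem cast_le_three_quarters_pow_mul {u k l N : ℕ} (h : 4 ^ k * u ≤ 3 ^ k * 2 ^ N)
    (hl : l ≤ k) : (u : ℝ) ≤ (3 / 4) ^ l * 2 ^ N := by
  have hreal : (4 : ℝ) ^ k * u ≤ 3 ^ k * 2 ^ N := by exact_mod_cast h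
  have h34 : (3 / 4 : ℝ) ^ k ≤ (3 / 4) ^ l :=
    pow_le_pow_of_le_one (by norm_num) (by norm_num) hl
  refine le_trans ?_ (mul_le_mul_of_nonneg_right h34 (by positivity))
  rw [div_pow, div_mul_eq_mul_div, le_div_iff₀ (by positivity), mul_comm]
  exact hreal

/-- Few families of triples link `a, b` to `c, d` by no element. -/
theorem card_unlinked_le {m : ℕ} (a b c d : Fin m) :
    (#{T : Finset (Sym (Fin m) 3) | ∀ x, ¬ (symTriple a b x ∈ T ∧ symTriple x c d ∈ T)} : ℝ) ≤
      (3 / 4) ^ (m - 4) * 2 ^ cycleCountQ (m + 1) (m + 1) := by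
  obtain ⟨X, hX, hmem⟩ : ∃ X : Finset (Fin m), m - 4 ≤ #X ∧
      ∀ x ∈ X, x ≠ a ∧ x ≠ b ∧ x ≠ c ∧ x ≠ d := by
    refine ⟨univ \ {a, b, c, d}, ?_, fun x hx => ?_⟩
    · refine le_trans ?_ (le_card_sdiff _ _)
      rw [card_univ, Fintype.card_fin]
      exact Nat.sub_le_sub_left card_le_four _
    · simpa only [mem_insert, mem_singleton, not_or] using (mem_sdiff.1 hx).2
  -- Only different x need be separated; for one x the two triples may coincide.
  have hdisj : ∀ x ∈ X, ∀ y ∈ X, x ≠ y → symTriple a b x ≠ symTriple a b y ∧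
      symTriple a b x ≠ symTriple y c d ∧ symTriple x c d ≠ symTriple y c d := by
    intro x hx y hy hxy
    have hx := hmem x hx
    refine ⟨fun e => ?_, fun e => ?_, fun e => ?_⟩
    · have : x ∈ symTriple a b y := e ▸ mem_symTriple.2 (Or.inr (Or.inr rfl))
      rw [mem_symTriple] at this
      tauto
    · have : x ∈ symTriple y c d := e ▸ mem_symTriple.2 (Or.inr (Or.inr rfl))
      rw [mem_symTriple] at this
      tauto
    · have : x ∈ symTriple y c d := e ▸ mem_symTriple.2 (Or.inl rfl)
      rw [mem_symTriple] at this
      tauto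
  have hcard := card_avoiding_pairs_le (symTriple a b) (fun x => symTriple x c d) X hdisj
  rw [card_sym_three] at hcard
  refine cast_le_three_quarters_pow_mul ((Nat.mul_le_mul_left _ ?_).trans hcard) hX
  refine card_le_card fun T hT => ?_
  exact (@mem_filter _ _ (_) _ _).2 ⟨mem_univ _, fun x _ => (mem_filter.1 hT).2 x⟩

open Classical in
theorem card_not_linked_le (m : ℕ) :
    (#{T : Finset (Sym (Fin m) 3) | ¬ Linked T} : ℝ) ≤
      (m : ℝ) ^ 4 * (3 / 4) ^ (m - 4) * 2 ^ cycleCountQ (m + 1) (m + 1) := by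
  let bad : Fin m × Fin m × Fin m × Fin m → Finset (Finset (Sym (Fin m) 3)) := fun z =>
    {T | ∀ x, ¬ (symTriple z.1 z.2.1 x ∈ T ∧ symTriple x z.2.2.1 z.2.2.2 ∈ T)}
  have hsub : ({T : Finset (Sym (Fin m) 3) | ¬ Linked T} : Finset _) ⊆ univ.biUnion bad := by
    intro T hT
    have hT := (mem_filter.1 hT).2
    unfold Linked at hT
    push Not at hT
    obtain ⟨a, b, c, d, h⟩ := hT
    exact mem_biUnion.2 ⟨(a, b, c, d), mem_univ _,
      mem_filter.2 ⟨mem_univ _, fun x hx => h x hx.1 hx.2⟩⟩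
  have hbad : ∀ z, (#(bad z) : ℝ) ≤ (3 / 4) ^ (m - 4) * 2 ^ cycleCountQ (m + 1) (m + 1) := by
    rintro ⟨a, b, c, d⟩
    convert card_unlinked_le a b c d
  have hle : (#{T : Finset (Sym (Fin m) 3) | ¬ Linked T} : ℝ) ≤ ∑ z, (#(bad z) : ℝ) := by
    rw [← Nat.cast_sum]
    exact Nat.cast_le.2 ((card_le_card hsub).trans card_biUnion_le)
  refine hle.trans ((sum_le_sum fun z _ => hbad z).trans (le_of_eq ?_))
  simp only [sum_const, card_univ, Fintype.card_prod, Fintype.card_fin, nsmul_eq_mul]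
  push_cast
  ring

open Classical in
-- Each fibre of the map from linked T to isomorphism classes lies in the image of the permutations
-- of the m diversity atoms.
theorem card_linked_le (m : ℕ) {P : FinNA → Prop}
    (hP : ∀ A : FinNA, A.IsAssociative → A.IsSymmetric → A.IdentityIsAtom → P A) :
    #{T : Finset (Sym (Fin m) 3) | Linked T} ≤ m ! * FinNA.numIsoClasses (m + 1) P := by
  let g : Finset (Sym (Fin m) 3) → Quotient FinNA.isoSetoid := fun T => ⟦symAlgebra T⟧
  have hfib := card_le_mul_card_image (f := g)
    (univ.filter fun T : Finset (Sym (Fin m) 3) => Linked T) (m !) fun c hc => by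
      obtain ⟨T₀, _, rfl⟩ := mem_image.1 hc
      have hperm : #(univ : Finset (Equiv.Perm (Fin m))) = m ! := by
        rw [card_univ, Fintype.card_perm, Fintype.card_fin]
      rw [← hperm]
      refine (card_le_card (t := univ.image fun p : Equiv.Perm (Fin m) =>
        univ.filter fun s : Sym (Fin m) 3 => s.map p ∈ T₀) fun T hT => ?_).trans card_image_le
      obtain ⟨p, hp⟩ := exists_perm_of_symAlgebra_equiv (Quotient.exact (mem_filter.1 hT).2)
      refine mem_image.2 ⟨p, mem_univ _, ?_⟩
      ext s
      simp [hp s]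
  refine hfib.trans (Nat.mul_le_mul_left _ ?_)
  rw [← Set.ncard_coe_finset]
  refine Set.ncard_le_ncard ?_ ((FinNA.finite_isoClasses (m + 1)).subset ?_)
  · intro c hc
    obtain ⟨T, hT, rfl⟩ := mem_image.1 (mem_coe.1 hc)
    exact ⟨symAlgebra T, symAlgebra_atomCount T, hP _ (mem_filter.1 hT).2.symAlgebra_isAssociative
      (symAlgebra_isSymmetric T) (symAlgebra_identityIsAtom T), rfl⟩
  · rintro c ⟨A, hA, _, hc⟩
    exact ⟨A, hA, hc⟩

theorem FinNA.le_factorial_mul_numIsoClasses (m : ℕ) {P : FinNA → Prop}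
    (hP : ∀ A : FinNA, A.IsAssociative → A.IsSymmetric → A.IdentityIsAtom → P A) :
    (2 : ℝ) ^ cycleCountQ (m + 1) (m + 1) * (1 - (m : ℝ) ^ 4 * (3 / 4) ^ (m - 4)) ≤
      m ! * FinNA.numIsoClasses (m + 1) P := by
  classical
  have h1 : (#{T : Finset (Sym (Fin m) 3) | Linked T} : ℝ) ≤
      m ! * FinNA.numIsoClasses (m + 1) P := by exact_mod_cast card_linked_le m hP
  have h2 := card_filter_add_card_filter_not (s := univ) fun T : Finset (Sym (Fin m) 3) => Linked T
  rw [card_univ, Fintype.card_finset, card_sym_three] at h2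
  have h3 : (#{T : Finset (Sym (Fin m) 3) | Linked T} : ℝ) +
      #{T : Finset (Sym (Fin m) 3) | ¬ Linked T} = 2 ^ cycleCountQ (m + 1) (m + 1) := by
    exact_mod_cast h2
  have h4 := card_not_linked_le m
  linarith

end Counting

/-! ### The error factors tend to 1 -/

section Limits

open Topology

theorem tendsto_upper_factor :
    Tendsto (fun n : ℕ => (1 + (2 : ℝ) ^ (-(n : ℝ) / 24)) ^ n *
      ((1 + ((n : ℝ) - 1) * 2 ^ (-(n : ℝ) / 24)) ^ n) ^ 2) atTop (𝓝 1) := by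
  set r : ℝ := 2 ^ (-(1 : ℝ) / 24) with hr
  have hr0 : 0 ≤ r := by positivity
  have hr1 : r < 1 := Real.rpow_lt_one_of_one_lt_of_neg one_lt_two (by norm_num)
  have hx : ∀ n : ℕ, (2 : ℝ) ^ (-(n : ℝ) / 24) = r ^ n := fun n => by
    rw [hr, ← Real.rpow_mul_natCast two_pos.le]
    congr 1; ring
  simp only [hx]
  -- Each of the three n-th powers is at most exp(n² rⁿ), by 1 + y ≤ exp y with y ≤ n rⁿ.
  have hlim : Tendsto (fun n : ℕ => Real.exp (3 * ((n : ℝ) ^ 2 * r ^ n))) atTop (𝓝 1) := by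
    have := (tendsto_pow_const_mul_const_pow_of_abs_lt_one 2
      (by rwa [abs_of_nonneg hr0] : |r| < 1)).const_mul 3
    rw [mul_zero] at this
    simpa using this.rexp
  refine tendsto_of_tendsto_of_tendsto_of_le_of_le' tendsto_const_nhds hlim ?_ ?_
  · filter_upwards [eventually_ge_atTop 1] with n hn
    have hn' : (1 : ℝ) ≤ n := by exact_mod_cast hn
    have h1 : 0 ≤ r ^ n := pow_nonneg hr0 n
    have h2 : 0 ≤ ((n : ℝ) - 1) * r ^ n := mul_nonneg (by linarith) h1
    exact one_le_mul_of_one_le_of_one_le (one_le_pow₀ (by linarith))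
      (one_le_pow₀ (one_le_pow₀ (by linarith)))
  · filter_upwards [eventually_ge_atTop 1] with n hn
    have hn' : (1 : ℝ) ≤ n := by exact_mod_cast hn
    have h1 : 0 ≤ r ^ n := pow_nonneg hr0 n
    have h2 : 0 ≤ ((n : ℝ) - 1) * r ^ n := mul_nonneg (by linarith) h1
    have key : ∀ y : ℝ, 0 ≤ y → y ≤ n * r ^ n → (1 + y) ^ n ≤ Real.exp ((n : ℝ) ^ 2 * r ^ n) := by
      intro y hy hyn
      calc (1 + y) ^ n ≤ (Real.exp y) ^ n :=
            pow_le_pow_left₀ (by linarith) (by linarith [Real.add_one_le_exp y]) n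
        _ = Real.exp (n * y) := (Real.exp_nat_mul y n).symm
        _ ≤ _ := by
          apply Real.exp_le_exp.2
          nlinarith
    have k1 := key (r ^ n) h1 (by nlinarith)
    have k2 := key (((n : ℝ) - 1) * r ^ n) h2 (by nlinarith)
    have e : Real.exp (3 * ((n : ℝ) ^ 2 * r ^ n)) =
        Real.exp ((n : ℝ) ^ 2 * r ^ n) * Real.exp ((n : ℝ) ^ 2 * r ^ n) ^ 2 := by
      rw [← Real.exp_nat_mul, ← Real.exp_add]
      congr 1; push_cast; ring
    rw [e]
    exact mul_le_mul k1 (pow_le_pow_left₀ (by positivity) k2 2) (by positivity) (by positivity)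

theorem tendsto_lower_factor :
    Tendsto (fun n : ℕ => 1 - ((n - 1 : ℕ) : ℝ) ^ 4 * (3 / 4 : ℝ) ^ (n - 1 - 4)) atTop (𝓝 1) := by
  have h0 : Tendsto (fun m : ℕ => (m : ℝ) ^ 4 * (3 / 4 : ℝ) ^ (m - 4)) atTop (𝓝 0) := by
    have h := (tendsto_pow_const_mul_const_pow_of_abs_lt_one 4
      (by rw [abs_of_nonneg] <;> norm_num : |(3 / 4 : ℝ)| < 1)).mul_const (((3 / 4 : ℝ) ^ 4)⁻¹)
    rw [zero_mul] at h
    refine h.congr' ?_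
    filter_upwards [eventually_ge_atTop 4] with m hm
    rw [mul_assoc, pow_sub₀ _ (by norm_num) hm]
  have := (h0.comp (tendsto_sub_atTop_nat 1)).const_sub 1
  rwa [sub_zero] at this

end Limits

/-! ### The asymptotic formula -/

theorem mainTheorem4 (S : Set (FinNA → Prop))
    (hS : S ⊆ {FinNA.IsAssociative, FinNA.IsSymmetric, FinNA.IdentityIsAtom}) :
    (fun n : ℕ => (FinNA.numIsoClasses n (fun A => ∀ P ∈ S, P A) : ℝ))
      ~[atTop] (fun n : ℕ => (2 : ℝ) ^ cycleCountQ n n / ((n - 1)! : ℝ)) := by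
  have hne : ∀ n : ℕ, (2 : ℝ) ^ cycleCountQ n n / ((n - 1)! : ℝ) ≠ 0 := fun n => by positivity
  rw [isEquivalent_iff_tendsto_one (Eventually.of_forall hne)]
  have hP : ∀ A : FinNA, A.IsAssociative → A.IsSymmetric → A.IdentityIsAtom → ∀ P ∈ S, P A := by
    intro A h1 h2 h3 P hP
    rcases hS hP with rfl | rfl | rfl
    exacts [h1, h2, h3]
  refine tendsto_of_tendsto_of_tendsto_of_le_of_le' tendsto_lower_factor tendsto_upper_factor ?_ ?_
  · filter_upwards [eventually_ge_atTop 1] with n hn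
    obtain ⟨m, rfl⟩ := Nat.exists_eq_add_of_le' hn
    have h := FinNA.le_factorial_mul_numIsoClasses m hP
    rw [Pi.div_apply, div_div_eq_mul_div, le_div_iff₀ (by positivity), Nat.add_sub_cancel]
    linarith
  · filter_upwards [eventually_ge_atTop 16] with n hn
    have h := FinNA.numIsoClasses_mul_factorial_le_real hn (fun A => ∀ P ∈ S, P A) rfl
    have hn0 : (0 : ℝ) < n := by exact_mod_cast (by omega : 0 < n)
    have hfac : (n ! : ℝ) = n * (n - 1)! := by
      rw [← Nat.mul_factorial_pred (by omega : n ≠ 0), Nat.cast_mul]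
    rw [Pi.div_apply, div_div_eq_mul_div, div_le_iff₀ (by positivity)]
    -- The factor n of the upper bound, from the choice of the identity atom, cancels against n! = n
    -- · (n - 1)!.
    refine le_of_mul_le_mul_left ?_ hn0
    rw [hfac] at h
    linarith
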